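/- Theorem 4.1. For each $n\ge 1$ let $\pi_n$ be a random permutation uniformly distributed on the symmetric group $\mathcal S_n$ of $\{1,\dots,n\}$. Let $$D_n=\#\{1\le k\le n-1:\ \pi_n(k)>\pi_n(k+1)\},\qquad D'_n=\#\{1\le k\le n-1:\ \pi_n^{-1}(k)>\pi_n^{-1}(k+1)\}$$ be the numbers of descents of $\pi_n$ and of its inverse. Let $L(t)=\log\big((e^t-1)/t\big)$ for real $t\neq 0$, $L(0)=0$, let $I(x)=\sup_{t\in\mathbb R}\{xt-L(t)\}\in[0,+\infty]$ for $x\in\mathbb R$, and let $I(x,y)=I(x)+I(y)$ for $x,y\in\mathbb R$. Then $(D_n/n,D'_n/n)_{n\ge1}$ satisfies a large deviation principle in $\mathbb R^2$ with speed $n$ and good rate function $I(x,y)$. That is, $I:\mathbb R^2\to[0,+\infty]$ is lower semicontinuous, the sets $\{(x,y):I(x,y)\le\alpha\}$ are compact for all real $\alpha$, and for every Borel set $\Gamma\subseteq\mathbb R^2$ $$-\inf_{\Gamma^\circ} I\ \le\ \liminf_{n\to\infty}\frac1n\log\mathbb P\Big(\Big(\frac{D_n}{n},\frac{D'_n}{n}\Big)\in\Gamma\Big)\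 \le\ \limsup_{n\to\infty}\frac1n\log\mathbb P\Big(\Big(\frac{D_n}{n},\frac{D'_n}{n}\Big)\in\Gamma\Big)\ \le\ -\inf_{\overline\Gamma} I,$$ where $\Gamma^\circ$ and $\overline\Gamma$ are the interior and the closure of $\Gamma$, $\log 0=-\infty$ and $\inf_\emptyset I=+\infty$. -/

import Mathlib

open MeasureTheory Filter Topology
open scoped ENNReal Nat

namespace DescentLDP

section LargeDeviations

variable {X : Type*} [TopologicalSpace X]

/-- A good rate function: a lower semicontinuous function with values in `[0, ∞]`, all of whose
sublevel sets `{x | I x ≤ α}`, `α` real, are compact. -/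
structure IsGoodRateFunction (I : X → EReal) : Prop where
  nonneg : ∀ x, 0 ≤ I x
  lowerSemicontinuous : LowerSemicontinuous I
  isCompact_sublevel : ∀ α : ℝ, IsCompact {x | I x ≤ (α : EReal)}

/-- The sequence `μ` of measures satisfies the large deviation principle with speed `n` and good
rate function `I`: for every Borel set `Γ`,
`- inf_{interior Γ} I ≤ liminf (1/n) log (μ n Γ) ≤ limsup (1/n) log (μ n Γ) ≤ - inf_{closure Γ} I`.
Here `log 0 = -∞`, and the infimum over the empty set is `+∞`. The middle inequality is automatic. -/
structure SatisfiesLDP [MeasurableSpace X] [BorelSpace X] (μ : ℕ → Measure X) (I : X → EReal) :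
    Prop where
  isGoodRateFunction : IsGoodRateFunction I
  lower_bound : ∀ Γ : Set X, MeasurableSet Γ →
    -(⨅ x ∈ interior Γ, I x) ≤ liminf (fun n : ℕ => ENNReal.log (μ n Γ) / (n : EReal)) atTop
  upper_bound : ∀ Γ : Set X, MeasurableSet Γ →
    limsup (fun n : ℕ => ENNReal.log (μ n Γ) / (n : EReal)) atTop ≤ -(⨅ x ∈ closure Γ, I x)

end LargeDeviations

section Permutations

/-- The number of descents of a permutation of `n` letters (indexed from `0`), i.e. the number
of positions `k` with `k + 1 < n` such that `σ k > σ (k + 1)`. -/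
def descents {n : ℕ} (σ : Equiv.Perm (Fin n)) : ℕ :=
  (Finset.univ.filter fun k : Fin n => ∃ h : (k : ℕ) + 1 < n, σ ⟨(k : ℕ) + 1, h⟩ < σ k).card

/-- The random permutation `π` is uniformly distributed on the symmetric group. -/
structure IsUniformPerm {n : ℕ} {Ω : Type*} [MeasurableSpace Ω] (P : Measure Ω)
    (π : Ω → Equiv.Perm (Fin n)) : Prop where
  measurableSet_fiber : ∀ σ, MeasurableSet (π ⁻¹' {σ})
  measure_fiber : ∀ σ, P (π ⁻¹' {σ}) = ((n ! : ℕ) : ℝ≥0∞)⁻¹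

end Permutations

/-- `L t = log ((exp t - 1) / t)`, extended to `t = 0` by continuity: `L 0 = 0`. -/
noncomputable def L (t : ℝ) : ℝ :=
  if t = 0 then 0 else Real.log ((Real.exp t - 1) / t)

/-- The Legendre transform `sup_t (x t - L t)` of `L`, with values in `[0, ∞]`. -/
noncomputable def rate (x : ℝ) : EReal :=
  ⨆ t : ℝ, ((x * t - L t : ℝ) : EReal)

/-- The rate function of the pair, `(x, y) ↦ I x + I y`. -/
noncomputable def jointRate (z : ℝ × ℝ) : EReal :=
  rate z.1 + rate z.2

end DescentLDP

namespace DescentLDP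

/-! The engine is an exact identity of Worpitzky type (`sum_rising`): averaged over the symmetric
group, the product of rising products at `x - des σ` and `y - des σ⁻¹` is the rising product at `x
y`. For natural `x`, `y` it counts increasing sequences in a lexicographic product in two ways;
polynomiality gives real `x`, `y`.

Take `x ≈ -n/t` and `y ≈ -n/s` and normalize. The mean becomes `∏ (1 + k/(xy))` over `k < n`; as
`xy` has order at least `n²`, it is subexponential (`eventually_mean_weight_bounds`). Each
normalized factor, a `weight`, is at most `exp (t d - n L t)` up to `exp (o(n))`, and this is sharp
when `d/n` is near `L' t` (`eventually_weight_le`, `eventually_le_weight_of_hasDerivAt`). The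
weights thus act as exponential tilts, and the two coordinates decouple.

Upper bound: near `(x, y)` choose `t`, `s` with `L' t = x`, `L' s = y`; the tilt there is about `exp
(n I(x, y))`, so Markov's inequality and compactness of the unit square conclude. Lower bound: the
same tilt moves all but an exponentially small mass to `(x, y)`, because away from that point the
tilt is exponentially smaller than `exp (n I)`; dividing by its value near `(x, y)` bounds the
probability below. -/

/-! ### Counting increasing sequences. -/

theorem card_orderEmbedding_fin (n m : ℕ) : Nat.card (Fin n ↪o Fin m) = m.choose n := by
  rw [Nat.card_congr Set.powersetCard.ofFinEmbEquiv, Set.powersetCard.card]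
  simp

/-- The number of steps below `k` which are not in `S`. -/
def stepsBelow {N : ℕ} (S : Finset (Fin N)) (k : Fin (N + 1)) : ℕ :=
  (Sᶜ.filter fun j => j.castSucc < k).card

theorem stepsBelow_succ {N : ℕ} (S : Finset (Fin N)) (k : Fin N) :
    stepsBelow S k.succ = stepsBelow S k.castSucc + if k ∈ S then 0 else 1 := by
  unfold stepsBelow
  have : (Sᶜ.filter fun j => j.castSucc < k.succ) =
      (Sᶜ.filter fun j => j.castSucc < k.castSucc) ∪ (if k ∈ S then ∅ else {k}) := by
    ext j
    by_cases hk : k ∈ S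
    · simp only [Finset.mem_filter, Finset.mem_compl, Fin.lt_def, Fin.val_succ, Fin.val_castSucc,
        hk, if_true, Finset.union_empty]
      constructor
      · rintro ⟨h1, h2⟩
        refine ⟨h1, lt_of_le_of_ne (by omega) fun h => h1 ?_⟩
        rwa [Fin.ext h]
      · rintro ⟨h1, h2⟩
        exact ⟨h1, by omega⟩
    · simp only [Finset.mem_filter, Finset.mem_compl, Fin.lt_def, Fin.val_succ, Fin.val_castSucc,
        hk, if_false, Finset.mem_union, Finset.mem_singleton, Fin.ext_iff]
      constructor
      · rintro ⟨h1, h2⟩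
        rcases Nat.lt_or_ge j.val k.val with h | h
        · exact Or.inl ⟨h1, h⟩
        · exact Or.inr (by omega)
      · rintro (⟨h1, h2⟩ | h)
        · exact ⟨h1, by omega⟩
        · rw [Fin.ext h]
          exact ⟨hk, by omega⟩
  rw [this, Finset.card_union_of_disjoint]
  · split_ifs <;> simp
  · split_ifs <;> simp

theorem stepsBelow_last {N : ℕ} (S : Finset (Fin N)) :
    stepsBelow S (Fin.last N) = N - S.card := by
  unfold stepsBelow
  rw [Finset.filter_true_of_mem, Finset.card_compl, Fintype.card_fin]
  intro j _
  exact Fin.castSucc_lt_last j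

theorem stepsBelow_mono {N : ℕ} (S : Finset (Fin N)) : Monotone (stepsBelow S) :=
  Fin.monotone_iff_le_succ.2 fun k => by rw [stepsBelow_succ]; omega

/-- The number of weakly increasing sequences which increase strictly at the steps in `S`. -/
theorem card_monotone_strict_at {N : ℕ} (S : Finset (Fin N)) (m : ℕ) :
    Nat.card {f : Fin (N + 1) → Fin m // ∀ k : Fin N,
      f k.castSucc ≤ f k.succ ∧ (k ∈ S → f k.castSucc < f k.succ)} =
      (m + (N - S.card)).choose (N + 1) := by
  rw [← card_orderEmbedding_fin]
  have hle : ∀ k, stepsBelow S k ≤ N - S.card := fun k => by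
    rw [← stepsBelow_last]; exact stepsBelow_mono S (Fin.le_last k)
  -- `stepsBelow` grows by at most one per step, so it stays below a strictly increasing `g` and the
  -- difference is monotone. Hence the natural subtraction is never truncated, and the bound `m`
  -- need only be checked at the last index.
  have key : ∀ g : Fin (N + 1) ↪o Fin (m + (N - S.card)), ∀ k,
      stepsBelow S k ≤ g k ∧ (g k : ℕ) - stepsBelow S k < m := by
    intro g
    have h1 : ∀ k, stepsBelow S k ≤ g k := by
      intro k
      induction k using Fin.induction with
      | zero => simp [stepsBelow]
      | succ k ih =>
        have : g k.castSucc < g k.succ := g.strictMono Fin.castSucc_lt_succ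
        rw [Fin.lt_def] at this
        rw [stepsBelow_succ]
        split_ifs <;> omega
    have h2 : Monotone fun k => ((g k : ℕ) - stepsBelow S k) := by
      refine Fin.monotone_iff_le_succ.2 fun k => ?_
      have : g k.castSucc < g k.succ := g.strictMono Fin.castSucc_lt_succ
      rw [Fin.lt_def] at this
      simp only [stepsBelow_succ]
      split_ifs <;> omega
    refine fun k => ⟨h1 k, lt_of_le_of_lt (h2 (Fin.le_last k)) ?_⟩
    have := h1 (Fin.last N)
    have h3 := (g (Fin.last N)).2
    simp only [stepsBelow_last] at this ⊢
    omega
  refine Nat.card_congr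
    { toFun := fun f => OrderEmbedding.ofStrictMono
        (fun k => ⟨f.1 k + stepsBelow S k, by have := (f.1 k).2; have := hle k; omega⟩) ?_
      invFun := fun g => ⟨fun k => ⟨g k - stepsBelow S k, (key g k).2⟩, ?_⟩
      left_inv := ?_
      right_inv := ?_ }
  · refine Fin.strictMono_iff_lt_succ.2 fun k => ?_
    obtain ⟨h1, h2⟩ := f.2 k
    rw [Fin.lt_def] at h2 ⊢
    rw [Fin.le_def] at h1
    simp only [stepsBelow_succ]
    split_ifs with hk
    · have := h2 hk
      omega
    · omega
  · intro k
    have : g k.castSucc < g k.succ := g.strictMono Fin.castSucc_lt_succ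
    have h1 := (key g k.castSucc).1
    have h2 := (key g k.succ).1
    rw [Fin.lt_def] at this
    simp only [Fin.le_def, Fin.lt_def, stepsBelow_succ] at h2 ⊢
    split_ifs at h2 ⊢ with hk
    · refine ⟨by omega, fun _ => by omega⟩
    · refine ⟨by omega, fun h => absurd h hk⟩
  · intro f
    ext k
    simp
  · intro g
    ext k
    simpa using Nat.sub_add_cancel (key g k).1

theorem card_monotone_fin (N m : ℕ) :
    Nat.card {f : Fin (N + 1) → Fin m // Monotone f} = (m + N).choose (N + 1) := by
  have := card_monotone_strict_at (∅ : Finset (Fin N)) m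
  simpa [Fin.monotone_iff_le_succ] using this

theorem card_monotone_lex (N i j : ℕ) :
    Nat.card {f : Fin (N + 1) → Fin i ×ₗ Fin j // Monotone f} = (i * j + N).choose (N + 1) := by
  rw [← card_monotone_fin]
  have e := monoEquivOfFin (Fin i ×ₗ Fin j) (k := i * j)
    (by rw [Fintype.card_lex]; simp)
  refine Nat.card_congr ((Equiv.arrowCongr (Equiv.refl _) e.symm.toEquiv).subtypeEquiv fun f => ?_)
  constructor
  · intro h
    exact e.symm.monotone.comp h
  · intro h a b hab
    exact (OrderIso.le_iff_le e.symm).1 (h hab)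

/-! ### Permutations with compatible sequences, and lexicographic sequences. -/

/-- The positions of the descents of a permutation of `N + 1` letters. -/
def descentSet {N : ℕ} (σ : Equiv.Perm (Fin (N + 1))) : Finset (Fin N) :=
  Finset.univ.filter fun k => σ k.succ < σ k.castSucc

theorem descents_eq_card {N : ℕ} (σ : Equiv.Perm (Fin (N + 1))) :
    descents σ = (descentSet σ).card := by
  unfold descents descentSet
  rw [← Finset.card_map (s := Finset.univ.filter fun k : Fin N => σ k.succ < σ k.castSucc)
    Fin.castSuccEmb]
  congr 1
  ext k
  simp only [Finset.mem_filter, Finset.mem_univ, true_and, Finset.mem_map]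
  constructor
  · rintro ⟨h, hk⟩
    exact ⟨⟨k, by omega⟩, hk, rfl⟩
  · rintro ⟨l, hl, rfl⟩
    exact ⟨by simp, hl⟩

theorem descents_le {N : ℕ} (σ : Equiv.Perm (Fin (N + 1))) : descents σ ≤ N := by
  rw [descents_eq_card]
  simpa using Finset.card_le_univ (descentSet σ)

/-- The sequences which increase weakly, and strictly at the descents of `σ`. -/
def Compatible {n : ℕ} (m : ℕ) (σ : Equiv.Perm (Fin n)) : Type :=
  {c : Fin n → Fin m // StrictMono fun k => toLex (c k, σ k)}

/-- Between consecutive indices the lexicographic condition is `<` on `c` at a descent of `σ` and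
`≤` elsewhere. -/
theorem card_compatible {N : ℕ} (m : ℕ) (σ : Equiv.Perm (Fin (N + 1))) :
    Nat.card (Compatible m σ) = (m + (N - descents σ)).choose (N + 1) := by
  rw [descents_eq_card, ← card_monotone_strict_at]
  refine Nat.card_congr (Equiv.subtypeEquivRight fun c => ?_)
  rw [Fin.strictMono_iff_lt_succ]
  refine forall_congr' fun k => ?_
  rw [Prod.Lex.toLex_lt_toLex']
  simp only [descentSet, Finset.mem_filter, Finset.mem_univ, true_and]
  have hne : σ k.castSucc ≠ σ k.succ := fun h =>
    (Fin.castSucc_lt_succ (i := k)).ne (σ.injective h)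
  constructor
  · rintro ⟨h1, h2⟩
    exact ⟨h1, fun h => lt_of_le_of_ne h1 fun he => (h2 he).not_gt h⟩
  · rintro ⟨h1, h2⟩
    exact ⟨h1, fun he => lt_of_le_of_ne (not_lt.1 fun h => (h2 h).ne he) hne⟩

/-- `Tuple.sort` is the stable sort: `c` is `c ∘ σ` rearranged by `σ⁻¹`, and ties must keep their
original order. -/
theorem strictMono_toLex_symm_iff {n m : ℕ} (σ : Equiv.Perm (Fin n)) (c : Fin n → Fin m) :
    (StrictMono fun k => toLex (c k, σ⁻¹ k)) ↔ σ⁻¹ = Tuple.sort (c ∘ σ) := by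
  rw [Tuple.eq_sort_iff]
  have hcomp : (c ∘ σ) ∘ (σ⁻¹ : Equiv.Perm (Fin n)) = c := by ext; simp
  have happ : ∀ k, (c ∘ σ) ((σ⁻¹ : Equiv.Perm (Fin n)) k) = c k := by simp
  rw [hcomp]
  simp only [happ]
  constructor
  · intro h
    refine ⟨fun a b hab => ?_, fun a b hab => ?_⟩
    · rcases hab.eq_or_lt with rfl | hab
      · rfl
      · exact (Prod.Lex.toLex_lt_toLex'.1 (h hab)).1
    · exact (Prod.Lex.toLex_lt_toLex'.1 (h hab)).2
  · rintro ⟨h1, h2⟩ a b hab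
    exact Prod.Lex.toLex_lt_toLex'.2 ⟨h1 hab.le, h2 a b hab⟩

/-- Here `σ` is the standardization of `f`: for `a < b`, `σ a < σ b` exactly when `f a ≤ f b`. So
`σ` can replace `f` as second coordinate, weak comparisons becoming strict. -/
theorem monotone_lex_iff {n i j : ℕ} (σ : Equiv.Perm (Fin n)) (c : Fin n → Fin i)
    (f : Fin n → Fin j) (hσ : σ⁻¹ = Tuple.sort f) :
    (StrictMono fun k => toLex (c k, σ k)) ↔ Monotone fun k => toLex (c k, f k) := by
  have hs := Tuple.eq_sort_iff.1 hσ
  have key : ∀ a b, a < b → (σ a < σ b ↔ f a ≤ f b) := by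
    intro a b hab
    constructor
    · intro h
      simpa using hs.1 h.le
    · intro h
      by_contra hlt
      have hlt' : σ b < σ a := lt_of_le_of_ne (not_lt.1 hlt) fun he => hab.ne' (σ.injective he)
      have h1 : f b ≤ f a := by simpa using hs.1 hlt'.le
      have := hs.2 _ _ hlt' (by simpa using le_antisymm h1 h)
      exact (by simpa using this : b < a).not_gt hab
  constructor
  · intro h a b hab
    rcases hab.eq_or_lt with rfl | hab
    · exact le_rfl
    · have := Prod.Lex.toLex_lt_toLex'.1 (h hab)
      exact Prod.Lex.toLex_le_toLex'.2 ⟨this.1, fun he => (key a b hab).1 (this.2 he)⟩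
  · intro h a b hab
    have := Prod.Lex.toLex_le_toLex'.1 (h hab.le)
    exact Prod.Lex.toLex_lt_toLex'.2 ⟨this.1, fun he => (key a b hab).2 (this.2 he)⟩

/-- A lexicographically increasing sequence of pairs amounts to a permutation together with
sequences compatible with it and with its inverse. -/
def compatibleEquiv (n i j : ℕ) :
    (Σ σ : Equiv.Perm (Fin n), Compatible i σ × Compatible j σ⁻¹) ≃
      {f : Fin n → Fin i ×ₗ Fin j // Monotone f} where
  toFun x := ⟨fun k => toLex (x.2.1.1 k, x.2.2.1 (x.1 k)),
    (monotone_lex_iff x.1 _ _ ((strictMono_toLex_symm_iff x.1 x.2.2.1).1 x.2.2.2)).1 x.2.1.2⟩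
  invFun f := ⟨(Tuple.sort fun k => (ofLex (f.1 k)).2)⁻¹,
    ⟨fun k => (ofLex (f.1 k)).1, (monotone_lex_iff _ _ (fun k => (ofLex (f.1 k)).2) (by simp)).2
      f.2⟩,
    ⟨fun k => (ofLex (f.1 (Tuple.sort (fun k => (ofLex (f.1 k)).2) k))).2,
      (strictMono_toLex_symm_iff _ _).2 (by
        rw [inv_inv]
        congr 1
        ext k
        simp)⟩⟩
  left_inv := by
    rintro ⟨σ, ⟨c, hc⟩, ⟨d, hd⟩⟩
    have h := (strictMono_toLex_symm_iff σ d).1 hd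
    have h' : (Tuple.sort fun k => d (σ k))⁻¹ = σ := by
      rw [show (fun k => d (σ k)) = d ∘ σ from rfl, ← h, inv_inv]
    have hsig : ∀ (τ : Equiv.Perm (Fin n)) (hτ : τ = σ) (c' : Compatible i τ)
        (d' : Compatible j τ⁻¹), c'.1 = c → d'.1 = d →
        (⟨τ, c', d'⟩ : Σ σ : Equiv.Perm (Fin n), Compatible i σ × Compatible j σ⁻¹) =
          ⟨σ, ⟨c, hc⟩, ⟨d, hd⟩⟩ := by
      rintro τ rfl c' d' rfl rfl
      rfl
    refine hsig _ h' _ _ rfl ?_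
    ext k
    have : σ (Tuple.sort (fun k => d (σ k)) k) = k := by
      rw [show (fun k => d (σ k)) = d ∘ σ from rfl, ← h]
      simp
    simp [this]
  right_inv := by
    rintro ⟨f, hf⟩
    ext k : 2
    simp

theorem sum_choose_mul_choose (N i j : ℕ) :
    ∑ σ : Equiv.Perm (Fin (N + 1)),
      (i + (N - descents σ)).choose (N + 1) * (j + (N - descents σ⁻¹)).choose (N + 1) =
      (i * j + N).choose (N + 1) := by
  rw [← card_monotone_lex, ← Nat.card_congr (compatibleEquiv (N + 1) i j)]
  have : ∀ (n m : ℕ) (σ : Equiv.Perm (Fin n)), Finite (Compatible m σ) := fun n m σ =>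
    inferInstanceAs (Finite {c : Fin n → Fin m // _})
  rw [Nat.card_sigma]
  simp only [Nat.card_prod, card_compatible]

/-! ### The identity for real arguments. -/

/-- The rising product `x (x + 1) ⋯ (x + n - 1)`. -/
noncomputable def rising (n : ℕ) (x : ℝ) : ℝ := ∏ k ∈ Finset.range n, (x + k)

/-- The factors are those of the descending factorial of `i + N - d`. For `i ≤ d` a factor is zero
and so is the binomial coefficient. -/
theorem rising_nat_sub {N d : ℕ} (hd : d ≤ N) (i : ℕ) :
    rising (N + 1) ((i : ℝ) - d) = ((N + 1)! : ℕ) * ((i + (N - d)).choose (N + 1) : ℝ) := by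
  rw [← Nat.cast_mul, ← Nat.descFactorial_eq_factorial_mul_choose,
    ← descPochhammer_eval_eq_descFactorial ℝ, descPochhammer_eval_eq_prod_range, rising,
    ← Finset.prod_range_reflect]
  refine Finset.prod_congr rfl fun k hk => ?_
  have : k ≤ N := by simpa [Nat.lt_succ_iff] using hk
  rw [show N + 1 - 1 - k = N - k by omega]
  push_cast [Nat.cast_sub this, Nat.cast_sub hd]
  ring

theorem sum_rising_nat (N i j : ℕ) :
    ∑ σ : Equiv.Perm (Fin (N + 1)),
      rising (N + 1) ((i : ℝ) - descents σ) * rising (N + 1) ((j : ℝ) - descents σ⁻¹) =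
      ((N + 1)! : ℕ) * rising (N + 1) ((i : ℝ) * j) := by
  have h := rising_nat_sub (Nat.zero_le N) (i * j)
  push_cast at h
  rw [sub_zero] at h
  rw [h, Nat.sub_zero, ← sum_choose_mul_choose]
  push_cast
  rw [Finset.mul_sum, Finset.mul_sum]
  refine Finset.sum_congr rfl fun σ _ => ?_
  rw [rising_nat_sub (descents_le _), rising_nat_sub (descents_le _)]
  ring

/-- Two polynomials which agree on the natural numbers agree everywhere. -/
theorem eval_eq_of_nat {p q : Polynomial ℝ} (h : ∀ i : ℕ, p.eval (i : ℝ) = q.eval (i : ℝ)) (x : ℝ) :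
    p.eval x = q.eval x := by
  rw [Polynomial.eq_of_infinite_eval_eq p q]
  refine (Set.infinite_range_of_injective (Nat.cast_injective (R := ℝ))).mono ?_
  rintro _ ⟨i, rfl⟩
  exact h i

open Polynomial in
theorem exists_rising_poly (n : ℕ) (a b : ℝ) :
    ∃ p : Polynomial ℝ, ∀ x, p.eval x = rising n (a * x + b) :=
  ⟨∏ k ∈ Finset.range n, (C a * X + C (b + k)), fun x => by
    rw [eval_prod, rising]
    refine Finset.prod_congr rfl fun k _ => ?_
    simp [add_assoc]⟩

/-- Passes from natural to real values in one variable, the other being frozen in `g` and `y`;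
`sum_rising` applies it once per variable. -/
theorem sum_rising_extend {ι : Type*} (s : Finset ι) (n : ℕ) (g d : ι → ℝ) (c y : ℝ)
    (h : ∀ i : ℕ, ∑ σ ∈ s, rising n ((i : ℝ) - d σ) * g σ = c * rising n ((i : ℝ) * y)) (x : ℝ) :
    ∑ σ ∈ s, rising n (x - d σ) * g σ = c * rising n (x * y) := by
  choose p hp using fun σ => exists_rising_poly n 1 (-d σ)
  obtain ⟨q, hq⟩ := exists_rising_poly n y 0
  have := eval_eq_of_nat (p := ∑ σ ∈ s, p σ * Polynomial.C (g σ)) (q := Polynomial.C c * q)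
    (fun i => by
      have := h i
      simp only [Polynomial.eval_finsetSum, Polynomial.eval_mul, Polynomial.eval_C, hp, hq]
      simpa [mul_comm, sub_eq_add_neg, add_comm] using this) x
  simp only [Polynomial.eval_finsetSum, Polynomial.eval_mul, Polynomial.eval_C, hp, hq] at this
  simpa [mul_comm, sub_eq_add_neg, add_comm] using this

/-- The bivariate Worpitzky identity of Carlitz, Roselle and Scoville. -/
theorem sum_rising (N : ℕ) (x y : ℝ) :
    ∑ σ : Equiv.Perm (Fin (N + 1)),
      rising (N + 1) (x - descents σ) * rising (N + 1) (y - descents σ⁻¹) =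
      ((N + 1)! : ℕ) * rising (N + 1) (x * y) := by
  refine sum_rising_extend _ _ _ (fun σ => (descents σ : ℝ)) _ _ (fun i => ?_) x
  have := sum_rising_extend Finset.univ (N + 1)
    (fun σ : Equiv.Perm (Fin (N + 1)) => rising (N + 1) ((i : ℝ) - descents σ))
    (fun σ => (descents σ⁻¹ : ℝ)) ((N + 1)! : ℕ) i (fun j => ?_) y
  · simpa only [mul_comm] using this
  · simpa only [mul_comm] using sum_rising_nat N i j

/-! ### Elementary estimates for products, factorials and binomials. -/

theorem eventually_prod_one_add_bounds (K : ℝ) {ε : ℝ} (hε : 0 < ε) :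
    ∀ᶠ n : ℕ in atTop, ∀ u : ℕ → ℝ, (∀ k < n, |u k| ≤ K / n) →
      Real.exp (-(n * ε)) ≤ ∏ k ∈ Finset.range n, (1 + u k) ∧
        ∏ k ∈ Finset.range n, (1 + u k) ≤ Real.exp (n * ε) := by
  have hlim : Tendsto (fun n : ℕ => K / (n : ℝ)) atTop (𝓝 0) := tendsto_const_div_atTop_nhds_zero_nat K
  have h1 : ∀ᶠ n : ℕ in atTop, K / (n : ℝ) < 1 - Real.exp (-ε) :=
    hlim.eventually_lt_const (by simpa using hε)
  have h2 : ∀ᶠ n : ℕ in atTop, K / (n : ℝ) < Real.exp ε - 1 :=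
    hlim.eventually_lt_const (by simpa using hε)
  filter_upwards [h1, h2] with n h1 h2 u hu
  have hl : ∀ k ∈ Finset.range n, Real.exp (-ε) ≤ 1 + u k := fun k hk => by
    have := (abs_le.1 (hu k (Finset.mem_range.1 hk))).1
    linarith
  have hr : ∀ k ∈ Finset.range n, 1 + u k ≤ Real.exp ε := fun k hk => by
    have := (abs_le.1 (hu k (Finset.mem_range.1 hk))).2
    linarith
  constructor
  · calc Real.exp (-(n * ε)) = ∏ _k ∈ Finset.range n, Real.exp (-ε) := by
          rw [Finset.prod_const, Finset.card_range, ← Real.exp_nat_mul]; ring_nf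
      _ ≤ _ := Finset.prod_le_prod (fun _ _ => (Real.exp_pos _).le) hl
  · calc _ ≤ ∏ _k ∈ Finset.range n, Real.exp ε :=
          Finset.prod_le_prod (fun k hk => (Real.exp_pos _).le.trans (hl k hk)) hr
      _ = _ := by rw [Finset.prod_const, Finset.card_range, ← Real.exp_nat_mul]

theorem exp_mul_pow_le_succ_pow {n : ℕ} (hn : 1 ≤ n) :
    Real.exp 1 * (n : ℝ) ^ (n + 1) ≤ ((n : ℝ) + 1) ^ (n + 1) := by
  have hn0 : (0 : ℝ) < n := by exact_mod_cast hn
  have h := Real.one_sub_inv_le_log_of_pos (x := ((n : ℝ) + 1) / n) (by positivity)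
  have h2 : (1 : ℝ) ≤ (n + 1 : ℕ) * Real.log (((n : ℝ) + 1) / n) := by
    have : (1 : ℝ) = (n + 1 : ℕ) * (1 - (((n : ℝ) + 1) / n)⁻¹) := by
      push_cast; field_simp; ring
    calc (1 : ℝ) = (n + 1 : ℕ) * (1 - (((n : ℝ) + 1) / n)⁻¹) := this
      _ ≤ _ := by gcongr
  have h3 : Real.exp 1 ≤ (((n : ℝ) + 1) / n) ^ (n + 1) := by
    calc Real.exp 1 ≤ Real.exp ((n + 1 : ℕ) * Real.log (((n : ℝ) + 1) / n)) := Real.exp_le_exp.2 h2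
      _ = _ := by rw [Real.exp_nat_mul, Real.exp_log (by positivity)]
  calc _ ≤ (((n : ℝ) + 1) / n) ^ (n + 1) * (n : ℝ) ^ (n + 1) := by gcongr
    _ = _ := by rw [← mul_pow]; congr 1; field_simp

theorem factorial_le_stirling {n : ℕ} (hn : 1 ≤ n) :
    (n ! : ℝ) ≤ Real.exp 1 * n * ((n : ℝ) ^ n * Real.exp (-n)) := by
  induction n, hn using Nat.le_induction with
  | base => rw [Real.exp_neg]; simp
  | succ n hn ih =>
    have h := exp_mul_pow_le_succ_pow hn
    have he : Real.exp (-((n + 1 : ℕ) : ℝ)) * Real.exp 1 = Real.exp (-n) := by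
      rw [← Real.exp_add]; push_cast; ring_nf
    rw [Nat.factorial_succ]
    push_cast at he ⊢
    calc ((n : ℝ) + 1) * n ! ≤ (n + 1) * (Real.exp 1 * n * ((n : ℝ) ^ n * Real.exp (-n))) := by gcongr
      _ = (n + 1) * (Real.exp 1 * Real.exp (-((n : ℝ) + 1))) * (Real.exp 1 * (n : ℝ) ^ (n + 1)) := by
          rw [← he]; ring
      _ ≤ (n + 1) * (Real.exp 1 * Real.exp (-((n : ℝ) + 1))) * (((n : ℝ) + 1) ^ (n + 1)) := by gcongr
      _ = _ := by ring

/-- A single term of the binomial expansion of `((1 - z) + z) ^ M`. It is used with `z = exp t`,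
which gives the optimal exponent. -/
theorem choose_mul_pow_le {M n : ℕ} (h : n ≤ M) {z : ℝ} (h0 : 0 ≤ z) (h1 : z ≤ 1) :
    (M.choose n : ℝ) * (z ^ (M - n) * (1 - z) ^ n) ≤ 1 := by
  have := add_pow (1 - z) z M
  rw [sub_add_cancel, one_pow] at this
  refine le_of_le_of_eq ?_ this.symm
  calc _ = (1 - z) ^ n * z ^ (M - n) * (M.choose n : ℝ) := by ring
    _ ≤ _ := Finset.single_le_sum (f := fun m => (1 - z) ^ m * z ^ (M - m) * (M.choose m : ℝ))
      (fun m _ => mul_nonneg (mul_nonneg (pow_nonneg (by linarith) _) (pow_nonneg h0 _))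
        (Nat.cast_nonneg _)) (by simpa [Nat.lt_succ_iff] using h)

/-- The primitive `x log x - x` of the logarithm. -/
noncomputable def logPrim (x : ℝ) : ℝ := x * Real.log x - x

theorem continuous_logPrim : Continuous logPrim := Real.continuous_mul_log.sub continuous_id

theorem logPrim_add_one_sub_le {y : ℝ} (hy : 0 ≤ y) :
    logPrim (y + 1) - logPrim y ≤ Real.log (y + 1) := by
  rcases hy.eq_or_lt with rfl | hy
  · simp [logPrim]
  · have h := Real.log_le_sub_one_of_pos (x := (y + 1) / y) (by positivity)
    rw [Real.log_div (by positivity) hy.ne'] at h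
    have : y * (Real.log (y + 1) - Real.log y) ≤ y * ((y + 1) / y - 1) := by gcongr
    have e : y * ((y + 1) / y - 1) = 1 := by field_simp; ring
    unfold logPrim
    nlinarith

/-- Integral comparison: each factor `y + k + 1` dominates the exponential of the integral of `log`
over `[y + k, y + k + 1]`. -/
theorem exp_logPrim_le_rising (n : ℕ) {y : ℝ} (hy : 0 ≤ y) :
    Real.exp (logPrim (y + n) - logPrim y) ≤ rising n (y + 1) := by
  induction n with
  | zero => simp [rising]
  | succ n ih =>
    have h := logPrim_add_one_sub_le (y := y + n) (by positivity)
    unfold rising at ih ⊢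
    rw [Finset.prod_range_succ]
    push_cast
    calc Real.exp (logPrim (y + (n + 1)) - logPrim y)
        ≤ Real.exp ((logPrim (y + n) - logPrim y) + Real.log (y + n + 1)) := by
          rw [← add_assoc]; apply Real.exp_le_exp.2; linarith
      _ = Real.exp (logPrim (y + n) - logPrim y) * (y + 1 + n) := by
          rw [Real.exp_add, Real.exp_log (by positivity)]; ring
      _ ≤ _ := by gcongr

theorem logPrim_mul {c v : ℝ} (hc : 0 < c) (hv : 0 ≤ v) :
    logPrim (c * v) = c * v * Real.log c + c * logPrim v := by
  rcases hv.eq_or_lt with rfl | hv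
  · simp [logPrim]
  · unfold logPrim
    rw [Real.log_mul hc.ne' hv.ne']
    ring

/-! ### Weights and their mean. -/

/-- The weight `∏ (1 + (k - d) / c)` by which the distribution of the descents is tilted. -/
noncomputable def weight (c : ℝ) (n d : ℕ) : ℝ := ∏ k ∈ Finset.range n, (1 + ((k : ℝ) - d) / c)

theorem weight_eq {c : ℝ} (hc : c ≠ 0) (n d : ℕ) : weight c n d = rising n (c - d) / c ^ n := by
  unfold weight rising
  rw [← Finset.card_range n, ← Finset.prod_const, Finset.card_range, ← Finset.prod_div_distrib]
  refine Finset.prod_congr rfl fun k _ => ?_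
  field_simp
  ring

/-- Reversing the order of the factors. With `L_eq_add_L_neg` this reduces positive `t` to negative
`t`. -/
theorem weight_neg {c : ℝ} {n d : ℕ} (hd : d < n) : weight (-c) n d = weight c n (n - 1 - d) := by
  unfold weight
  rw [← Finset.prod_range_reflect]
  refine Finset.prod_congr rfl fun k hk => ?_
  have hk := Finset.mem_range.1 hk
  push_cast [Nat.cast_sub (show d ≤ n - 1 by omega), Nat.cast_sub (show k ≤ n - 1 by omega)]
  rw [div_neg, ← neg_div]
  ring

theorem weight_nat {i N d : ℕ} (hi : 0 < i) (hd : d ≤ N) :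
    weight i (N + 1) d = ((N + 1)! : ℕ) * ((i + (N - d)).choose (N + 1) : ℝ) / (i : ℝ) ^ (N + 1) := by
  rw [weight_eq (by positivity), rising_nat_sub hd]

theorem mean_weight {c c' : ℝ} (hc : c ≠ 0) (hc' : c' ≠ 0) (N : ℕ) :
    (∑ σ : Equiv.Perm (Fin (N + 1)),
      weight c (N + 1) (descents σ) * weight c' (N + 1) (descents σ⁻¹)) / ((N + 1)! : ℕ) =
      ∏ k ∈ Finset.range (N + 1), (1 + (k : ℝ) / (c * c')) := by
  have h1 : ∀ k ∈ Finset.range (N + 1), (1 + (k : ℝ) / (c * c')) = (c * c' + k) / (c * c') := by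
    intro k _; field_simp
  rw [Finset.prod_congr rfl h1, Finset.prod_div_distrib, Finset.prod_const, Finset.card_range]
  have h := sum_rising N c c'
  rw [rising.eq_def (N + 1) (c * c')] at h
  simp only [weight_eq hc, weight_eq hc']
  have hf : (((N + 1)! : ℕ) : ℝ) ≠ 0 := by positivity
  rw [eq_div_iff (by positivity), div_mul_eq_mul_div, div_eq_iff hf, mul_comm _ (((N + 1)! : ℕ) : ℝ),
    ← h, Finset.sum_mul]
  refine Finset.sum_congr rfl fun σ _ => ?_
  rw [mul_pow]
  field_simp

/-- The parameter of the weight which tilts by `t`: an integer near `-n / t`. -/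
noncomputable def scale (t : ℝ) (n : ℕ) : ℝ :=
  if t < 0 then (⌈(n : ℝ) / (-t)⌉₊ : ℝ) else if 0 < t then -(⌈(n : ℝ) / t⌉₊ : ℝ) else (n : ℝ) ^ 2

theorem scale_of_neg {t : ℝ} (ht : t < 0) (n : ℕ) : scale t n = (⌈(n : ℝ) / (-t)⌉₊ : ℝ) := by
  simp [scale, ht]

theorem scale_of_pos {t : ℝ} (ht : 0 < t) (n : ℕ) : scale t n = -scale (-t) n := by
  simp [scale, ht, ht.not_gt]

theorem scale_zero (n : ℕ) : scale 0 n = (n : ℝ) ^ 2 := by simp [scale]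

/-- Linear growth of both scales makes their product at least of order `n²`, so the factors of the
mean weight are `1 + O(1/n)`. -/
theorem exists_le_abs_scale (t : ℝ) : ∃ κ > 0, ∀ n : ℕ, κ * n ≤ |scale t n| := by
  have key : ∀ t : ℝ, t < 0 → ∃ κ > 0, ∀ n : ℕ, κ * n ≤ |scale t n| := fun t ht =>
    ⟨1 / (-t), by simpa using ht, fun n => by
      rw [scale_of_neg ht, abs_of_nonneg (by positivity), one_div_mul_eq_div]
      exact Nat.le_ceil _⟩
  rcases lt_trichotomy t 0 with ht | rfl | ht
  · exact key t ht
  · refine ⟨1, one_pos, fun n => ?_⟩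
    rw [scale_zero, abs_of_nonneg (by positivity), one_mul]
    exact_mod_cast Nat.le_self_pow two_ne_zero n
  · obtain ⟨κ, h1, h2⟩ := key (-t) (by linarith)
    exact ⟨κ, h1, fun n => by rw [scale_of_pos ht, abs_neg]; exact h2 n⟩

theorem scale_ne_zero (t : ℝ) {n : ℕ} (hn : 0 < n) : scale t n ≠ 0 := by
  obtain ⟨κ, h1, h2⟩ := exists_le_abs_scale t
  have : 0 < κ * n := by positivity
  exact abs_pos.1 (this.trans_le (h2 n))

theorem weight_scale_of_pos {t : ℝ} (ht : 0 < t) {n d : ℕ} (hd : d < n) :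
    weight (scale t n) n d = weight (scale (-t) n) n (n - 1 - d) := by
  rw [scale_of_pos ht, weight_neg hd]

theorem abs_sub_div_sq_le {n d k : ℕ} (hd : d < n) (hk : k < n) :
    |((k : ℝ) - d) / (n : ℝ) ^ 2| ≤ 1 / n := by
  have hn : (0 : ℝ) < n := by exact_mod_cast (Nat.zero_le d).trans_lt hd
  have hd' : (d : ℝ) < n := by exact_mod_cast hd
  have hk' : (k : ℝ) < n := by exact_mod_cast hk
  rw [abs_div, abs_of_pos (a := (n : ℝ) ^ 2) (by positivity), div_le_div_iff₀ (by positivity) hn]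
  have : |(k : ℝ) - d| ≤ n := by
    rw [abs_le]; constructor <;> linarith [Nat.cast_nonneg (α := ℝ) k, Nat.cast_nonneg (α := ℝ) d]
  nlinarith

/-- Individual factors may be negative. For `t < 0` the scale is an integer, so the weight is a
multiple of a binomial coefficient; `t > 0` follows by reflection. For `t = 0` the scale `n²` keeps
every factor nonnegative. -/
theorem weight_scale_nonneg (t : ℝ) {n d : ℕ} (hd : d < n) : 0 ≤ weight (scale t n) n d := by
  have key : ∀ t : ℝ, t < 0 → ∀ d < n, 0 ≤ weight (scale t n) n d := by
    intro t ht d hd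
    obtain ⟨N, rfl⟩ : ∃ N, n = N + 1 := ⟨n - 1, by omega⟩
    have h0 := scale_ne_zero t N.succ_pos
    rw [scale_of_neg ht] at h0 ⊢
    rw [weight_nat (Nat.pos_of_ne_zero (by exact_mod_cast h0)) (by omega)]
    positivity
  rcases lt_trichotomy t 0 with ht | rfl | ht
  · exact key t ht d hd
  · rw [scale_zero]
    refine Finset.prod_nonneg fun k hk => ?_
    have h := (abs_le.1 (abs_sub_div_sq_le hd (Finset.mem_range.1 hk))).1
    have : (1 : ℝ) / n ≤ 1 := by
      rw [div_le_one (by exact_mod_cast (Nat.zero_le d).trans_lt hd)]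
      exact_mod_cast (Nat.zero_le d).trans_lt hd
    linarith
  · rw [weight_scale_of_pos ht hd]
    exact key (-t) (by linarith) _ (by omega)

theorem eventually_mean_weight_bounds (t s : ℝ) {ε : ℝ} (hε : 0 < ε) :
    ∀ᶠ n : ℕ in atTop,
      Real.exp (-(n * ε)) ≤ (∑ σ : Equiv.Perm (Fin n),
        weight (scale t n) n (descents σ) * weight (scale s n) n (descents σ⁻¹)) / (n ! : ℕ) ∧
      (∑ σ : Equiv.Perm (Fin n),
        weight (scale t n) n (descents σ) * weight (scale s n) n (descents σ⁻¹)) / (n ! : ℕ) ≤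
        Real.exp (n * ε) := by
  obtain ⟨κ, hκ, h1⟩ := exists_le_abs_scale t
  obtain ⟨κ', hκ', h2⟩ := exists_le_abs_scale s
  filter_upwards [eventually_prod_one_add_bounds (1 / (κ * κ')) hε, eventually_ge_atTop 1]
    with n hn hn1
  have e : (∑ σ : Equiv.Perm (Fin n),
      weight (scale t n) n (descents σ) * weight (scale s n) n (descents σ⁻¹)) / (n ! : ℕ) =
      ∏ k ∈ Finset.range n, (1 + (k : ℝ) / (scale t n * scale s n)) := by
    obtain ⟨N, rfl⟩ : ∃ N, n = N + 1 := ⟨n - 1, by omega⟩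
    exact mean_weight (scale_ne_zero t N.succ_pos) (scale_ne_zero s N.succ_pos) N
  rw [e]
  refine hn _ fun k hk => ?_
  have hn0 : (0 : ℝ) < n := by exact_mod_cast hn1
  rw [abs_div, abs_mul, Nat.abs_cast]
  calc (k : ℝ) / (|scale t n| * |scale s n|) ≤ n / ((κ * n) * (κ' * n)) := by
        gcongr
        · exact h1 n
        · exact h2 n
    _ = _ := by field_simp

/-! ### The function `L` and its Legendre transform. -/

/-- The moment generating function `(exp t - 1) / t` of the uniform distribution. -/
noncomputable def mgfUnif (t : ℝ) : ℝ := if t = 0 then 1 else (Real.exp t - 1) / t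

theorem L_eq_log (t : ℝ) : L t = Real.log (mgfUnif t) := by
  unfold L mgfUnif
  split_ifs <;> simp

theorem L_zero : L 0 = 0 := by simp [L]

theorem mgfUnif_pos (t : ℝ) : 0 < mgfUnif t := by
  unfold mgfUnif
  split_ifs with h
  · exact one_pos
  · rcases lt_or_gt_of_ne h with h | h
    · exact div_pos_of_neg_of_neg (by simpa using h) h
    · exact div_pos (by simpa using h) h

theorem L_eq_add_L_neg (t : ℝ) : L t = t + L (-t) := by
  by_cases h : t = 0
  · simp [h, L_zero]
  · have hp := mgfUnif_pos (-t)
    rw [L_eq_log, L_eq_log]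
    nth_rewrite 2 [← Real.log_exp t]
    rw [← Real.log_mul (Real.exp_pos t).ne' hp.ne']
    congr 1
    have hn : -t ≠ 0 := neg_ne_zero.2 h
    simp only [mgfUnif, h, hn, if_false]
    rw [mul_div_assoc', mul_sub, ← Real.exp_add]
    simp only [add_neg_cancel, Real.exp_zero, mul_one]
    rw [div_neg, ← neg_div, neg_sub]

theorem L_of_neg {t : ℝ} (ht : t < 0) : L t = Real.log (1 - Real.exp t) - Real.log (-t) := by
  rw [L, if_neg ht.ne, ← Real.log_div]
  · rw [div_neg, ← neg_div, neg_sub]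
  · have : Real.exp t < 1 := by simpa using ht
    linarith
  · linarith

theorem hasDerivAt_L_of_ne {t : ℝ} (ht : t ≠ 0) :
    HasDerivAt L (Real.exp t / (Real.exp t - 1) - 1 / t) t := by
  have hp := mgfUnif_pos t
  have he : Real.exp t - 1 ≠ 0 := by
    intro h
    simp [mgfUnif, ht, h] at hp
  have h1 : HasDerivAt (fun s => (Real.exp s - 1) / s)
      ((Real.exp t * t - (Real.exp t - 1) * 1) / t ^ 2) t :=
    ((Real.hasDerivAt_exp t).sub_const 1).div (hasDerivAt_id t) ht
  have h2 := h1.log (div_ne_zero he ht)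
  have h3 : (Real.exp t * t - (Real.exp t - 1) * 1) / t ^ 2 / ((Real.exp t - 1) / t) =
      Real.exp t / (Real.exp t - 1) - 1 / t := by
    field_simp
  rw [h3] at h2
  refine h2.congr_of_eventuallyEq ?_
  filter_upwards [isOpen_ne.mem_nhds ht] with s hs
  simp [L, show s ≠ 0 from hs]

theorem hasDerivAt_mgfUnif_zero : HasDerivAt mgfUnif (1 / 2) 0 := by
  rw [hasDerivAt_iff_isLittleO]
  have h0 : mgfUnif 0 = 1 := by simp [mgfUnif]
  have hsq : (fun t : ℝ => t ^ 2) =o[𝓝 0] fun t => t - 0 := by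
    simpa using Asymptotics.isLittleO_pow_id (𝕜 := ℝ) (n := 2) one_lt_two
  refine Asymptotics.IsBigO.trans_isLittleO (Asymptotics.IsBigO.of_bound 1 ?_) hsq
  filter_upwards [Metric.ball_mem_nhds (0 : ℝ) one_pos] with t ht
  have ht : |t| ≤ 1 := by
    have := (Metric.mem_ball.1 ht).le
    rwa [Real.dist_eq, sub_zero] at this
  rw [h0]
  by_cases h : t = 0
  · simp [h, mgfUnif]
  · have hb := Real.exp_bound ht (n := 3) (by norm_num)
    norm_num [Finset.sum_range_succ, Nat.factorial] at hb
    have habs : 0 < |t| := abs_pos.2 h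
    have e : mgfUnif t - 1 - (t - 0) • (1 / 2 : ℝ) = (Real.exp t - (1 + t + t ^ 2 / 2)) / t := by
      simp only [mgfUnif, h, if_false, smul_eq_mul]
      field_simp
      ring
    rw [e, norm_div, Real.norm_eq_abs, Real.norm_eq_abs, div_le_iff₀ habs]
    simp only [norm_pow, Real.norm_eq_abs, one_mul]
    have : 0 ≤ |t| ^ 3 := by positivity
    nlinarith

theorem hasDerivAt_L_zero : HasDerivAt L (1 / 2) 0 := by
  have h := hasDerivAt_mgfUnif_zero.log (mgfUnif_pos 0).ne'
  have h0 : mgfUnif 0 = 1 := by simp [mgfUnif]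
  rw [h0, div_one] at h
  exact h.congr_of_eventuallyEq (Eventually.of_forall L_eq_log)

theorem differentiable_L : Differentiable ℝ L := fun t => by
  by_cases h : t = 0
  · rw [h]; exact hasDerivAt_L_zero.differentiableAt
  · exact (hasDerivAt_L_of_ne h).differentiableAt

/-- For `U` uniform on `[0, 1]`, the event `U ≤ c` alone contributes at least `c exp (t c)` to the
mean of `exp (t U)`. -/
theorem le_L_of_neg {t c : ℝ} (ht : t < 0) (hc : 0 < c) (hc1 : c ≤ 1) :
    t * c + Real.log c ≤ L t := by
  have h1 : Real.exp t ≤ Real.exp (t * c) := Real.exp_le_exp.2 (by nlinarith)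
  have h2 : -(t * c) + 1 ≤ Real.exp (-(t * c)) := Real.add_one_le_exp _
  have hE := Real.exp_pos (t * c)
  have h3 : Real.exp (t * c) * Real.exp (-(t * c)) = 1 := by rw [← Real.exp_add]; simp
  have h4 : Real.exp (t * c) * (-(t * c) + 1) ≤ 1 := (mul_le_mul_of_nonneg_left h2 hE.le).trans_eq h3
  have h5 : Real.exp (t * c) * c ≤ mgfUnif t := by
    simp only [mgfUnif, ht.ne, if_false]
    rw [le_div_iff_of_neg ht]
    nlinarith
  rw [L_eq_log, ← Real.log_exp (t * c), ← Real.log_mul hE.ne' hc.ne']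
  exact Real.log_le_log (by positivity) h5

theorem le_L_of_pos {t c : ℝ} (ht : 0 < t) (hc : 0 < c) (hc1 : c ≤ 1) :
    t - t * c + Real.log c ≤ L t := by
  have := le_L_of_neg (t := -t) (by linarith) hc hc1
  rw [L_eq_add_L_neg]
  linarith

theorem log_neg_le_neg_L {t : ℝ} (ht : t < 0) : Real.log (-t) ≤ -L t := by
  have h1 : Real.log (1 - Real.exp t) ≤ 0 := by
    have : Real.exp t < 1 := by simpa using ht
    refine Real.log_nonpos (by linarith) (by linarith [Real.exp_pos t])
  rw [L_of_neg ht]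
  linarith

theorem le_rate (x t : ℝ) : ((x * t - L t : ℝ) : EReal) ≤ rate x :=
  le_iSup (fun t : ℝ => ((x * t - L t : ℝ) : EReal)) t

theorem rate_nonneg (x : ℝ) : 0 ≤ rate x := by
  simpa [L_zero] using le_rate x 0

theorem rate_ne_bot (x : ℝ) : rate x ≠ ⊥ := fun h => by
  simpa [h] using rate_nonneg x

theorem rate_one_sub (x : ℝ) : rate (1 - x) = rate x := by
  unfold rate
  refine (Equiv.neg ℝ).iSup_congr fun t => ?_
  rw [Equiv.neg_apply, L_eq_add_L_neg t]
  congr 1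
  ring

theorem rate_of_nonpos {x : ℝ} (hx : x ≤ 0) : rate x = ⊤ := by
  rw [EReal.eq_top_iff_forall_lt]
  intro y
  -- At this point `-L` is at least `y + 1`, while `x t ≥ 0` because `x ≤ 0` and `t < 0`.
  have hneg : -Real.exp (y + 1) < 0 := by simpa using Real.exp_pos (y + 1)
  refine lt_of_lt_of_le ?_ (le_rate x (-Real.exp (y + 1)))
  have h := log_neg_le_neg_L hneg
  rw [neg_neg, Real.log_exp] at h
  rw [EReal.coe_lt_coe_iff]
  nlinarith

theorem rate_of_one_le {x : ℝ} (hx : 1 ≤ x) : rate x = ⊤ := by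
  rw [← rate_one_sub]
  exact rate_of_nonpos (by linarith)

theorem mem_Ioo_of_rate_lt_top {x : ℝ} (h : rate x < ⊤) : x ∈ Set.Ioo (0 : ℝ) 1 := by
  constructor
  · by_contra! hx
    simp [rate_of_nonpos hx] at h
  · by_contra! hx
    simp [rate_of_one_le hx] at h

theorem exists_hasDerivAt_L {x : ℝ} (hx : x ∈ Set.Ioo (0 : ℝ) 1) :
    ∃ t, HasDerivAt L x t ∧ rate x = ((x * t - L t : ℝ) : EReal) := by
  obtain ⟨hx0, hx1⟩ := hx
  have hcont : Continuous fun t => x * t - L t :=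
    (continuous_const.mul continuous_id).sub differentiable_L.continuous
  -- The slopes `x / 2` and `(1 - x) / 2` leave a linear term that pushes `x t - L t` below its
  -- value `0` at the origin for large `|t|`. Hence the supremum is attained, and `L' = x` there.
  obtain ⟨t, ht⟩ := hcont.exists_forall_ge' 0 (by
    rw [cocompact_eq_atBot_atTop, eventually_sup, L_zero]
    constructor
    · filter_upwards [eventually_lt_atBot 0, eventually_le_atBot (Real.log (x / 2) / (x / 2))]
        with t h1 h2
      have := le_L_of_neg h1 (c := x / 2) (by linarith) (by linarith)
      rw [le_div_iff₀ (by linarith)] at h2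
      linarith
    · filter_upwards [eventually_gt_atTop 0,
        eventually_ge_atTop (-Real.log ((1 - x) / 2) / ((1 - x) / 2))] with t h1 h2
      have := le_L_of_pos h1 (c := (1 - x) / 2) (by linarith) (by linarith)
      rw [div_le_iff₀ (by linarith)] at h2
      linarith)
  refine ⟨t, ?_, le_antisymm (iSup_le fun s => by exact_mod_cast ht s) (le_rate x t)⟩
  have hd := (differentiable_L t).hasDerivAt
  have h1 : HasDerivAt (fun t => x * t - L t) (x * 1 - deriv L t) t :=
    ((hasDerivAt_id t).const_mul x).sub hd
  have hmax : IsLocalMax (fun t => x * t - L t) t := Eventually.of_forall ht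
  have h2 := hmax.hasDerivAt_eq_zero h1
  rwa [show deriv L t = x by linarith] at hd

/-- The supporting line of the rate function at `x` touches it only there. -/
theorem lt_rate_of_ne {x x' t : ℝ} (ht : HasDerivAt L x t) (hne : x' ≠ x) :
    ((x' * t - L t : ℝ) : EReal) < rate x' := by
  by_contra! h
  have hmax : ∀ s, x' * s - L s ≤ x' * t - L t := fun s => by
    exact_mod_cast (le_rate x' s).trans h
  have h1 : HasDerivAt (fun t => x' * t - L t) (x' * 1 - x) t :=
    ((hasDerivAt_id t).const_mul x').sub ht
  have hloc : IsLocalMax (fun t => x' * t - L t) t := Eventually.of_forall hmax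
  have h2 := hloc.hasDerivAt_eq_zero h1
  exact hne (by linarith)

theorem lowerSemicontinuous_rate : LowerSemicontinuous rate :=
  lowerSemicontinuous_iSup fun t =>
    (continuous_coe_real_ereal.comp (by fun_prop : Continuous fun x : ℝ => x * t - L t))
      |>.lowerSemicontinuous

theorem jointRate_nonneg (z : ℝ × ℝ) : 0 ≤ jointRate z :=
  add_nonneg (rate_nonneg _) (rate_nonneg _)

theorem lowerSemicontinuous_jointRate : LowerSemicontinuous jointRate :=
  (lowerSemicontinuous_rate.comp continuous_fst).add'
    (lowerSemicontinuous_rate.comp continuous_snd) fun _ =>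
      EReal.continuousAt_add (Or.inr (rate_ne_bot _)) (Or.inl (rate_ne_bot _))

theorem rate_lt_top_of_jointRate_lt_top {z : ℝ × ℝ} (h : jointRate z < ⊤) :
    rate z.1 < ⊤ ∧ rate z.2 < ⊤ :=
  ⟨lt_of_le_of_lt (le_add_of_nonneg_right (rate_nonneg _)) h,
    lt_of_le_of_lt (le_add_of_nonneg_left (rate_nonneg _)) h⟩

theorem isGoodRateFunction_jointRate : IsGoodRateFunction jointRate where
  nonneg := jointRate_nonneg
  lowerSemicontinuous := lowerSemicontinuous_jointRate
  isCompact_sublevel α := by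
    refine (isCompact_Icc.prod isCompact_Icc : IsCompact
      (Set.Icc (0 : ℝ) 1 ×ˢ Set.Icc (0 : ℝ) 1)).of_isClosed_subset
      (lowerSemicontinuous_jointRate.isClosed_preimage _) fun z hz => ?_
    obtain ⟨h1, h2⟩ := rate_lt_top_of_jointRate_lt_top
      (lt_of_le_of_lt (show jointRate z ≤ α from hz) (EReal.coe_lt_top α))
    exact ⟨Set.Ioo_subset_Icc_self (mem_Ioo_of_rate_lt_top h1),
      Set.Ioo_subset_Icc_self (mem_Ioo_of_rate_lt_top h2)⟩

/-! ### Upper bound for the weights. -/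

theorem eventually_mul_le_exp (C : ℝ) {ε : ℝ} (hε : 0 < ε) :
    ∀ᶠ n : ℕ in atTop, C * (n : ℝ) ^ 2 ≤ Real.exp (n * ε) := by
  have h := (isLittleO_pow_exp_pos_mul_atTop 2 hε).comp_tendsto tendsto_natCast_atTop_atTop
  have h2 := (h.const_mul_left C).def one_pos
  filter_upwards [h2] with n hn
  simp only [Function.comp_apply, Real.norm_eq_abs, one_mul, abs_of_pos (Real.exp_pos _)] at hn
  rw [mul_comm (n : ℝ) ε]
  exact (le_abs_self _).trans hn

theorem eventually_factorial_le {ε : ℝ} (hε : 0 < ε) :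
    ∀ᶠ n : ℕ in atTop, (n ! : ℝ) ≤ Real.exp (n * ε) * ((n : ℝ) ^ n * Real.exp (-n)) := by
  filter_upwards [eventually_mul_le_exp (Real.exp 1) hε, eventually_ge_atTop 1] with n hn h1
  have h1' : (1 : ℝ) ≤ n := by exact_mod_cast h1
  refine (factorial_le_stirling h1).trans ?_
  gcongr
  refine le_trans ?_ hn
  gcongr
  nlinarith

theorem eventually_weight_le_of_neg {t : ℝ} (ht : t < 0) {ε : ℝ} (hε : 0 < ε) :
    ∀ᶠ n : ℕ in atTop, ∀ d < n,
      weight (scale t n) n d ≤ Real.exp (n * ε) * Real.exp (t * d - n * L t) := by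
  filter_upwards [eventually_factorial_le hε, eventually_ge_atTop 1] with n hn hn1 d hd
  obtain ⟨N, rfl⟩ : ∃ N, n = N + 1 := ⟨n - 1, by omega⟩
  have h0 := scale_ne_zero t N.succ_pos
  rw [scale_of_neg ht] at h0 ⊢
  have hle := Nat.le_ceil (((N + 1 : ℕ) : ℝ) / (-t))
  have hlt := Nat.ceil_lt_add_one (a := ((N + 1 : ℕ) : ℝ) / (-t)) (div_nonneg (by positivity) (by linarith))
  generalize ⌈((N + 1 : ℕ) : ℝ) / (-t)⌉₊ = i at h0 hle hlt ⊢
  have hi : 0 < i := Nat.pos_of_ne_zero (by exact_mod_cast h0)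
  have hi' : (0 : ℝ) < i := by exact_mod_cast hi
  rw [weight_nat hi (by omega), div_le_iff₀ (by positivity)]
  -- For `d ≥ i` the binomial coefficient, hence the weight, vanishes.
  rcases Nat.lt_or_ge d i with hdi | hdi
  swap
  · rw [Nat.choose_eq_zero_of_lt (by omega)]
    simp only [Nat.cast_zero, mul_zero]
    positivity
  have ht' : 0 < -t := by linarith
  have hz1 : Real.exp t < 1 := by simpa using ht
  have hq : 0 < 1 - Real.exp t := by linarith
  have hc := choose_mul_pow_le (M := i + (N - d)) (n := N + 1) (by omega) (Real.exp_pos t).le hz1.le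
  have hr : ((i + (N - d) - (N + 1) : ℕ) : ℝ) = (i : ℝ) - d - 1 := by
    rw [show i + (N - d) - (N + 1) = i - (d + 1) by omega, Nat.cast_sub (by omega)]
    push_cast; ring
  generalize hn' : N + 1 = n at *
  have e1 : Real.exp t ^ (i + (N - d) - n) * (1 - Real.exp t) ^ n =
      Real.exp (((i : ℝ) - d - 1) * t + n * Real.log (1 - Real.exp t)) := by
    rw [Real.exp_add, Real.exp_nat_mul, Real.exp_log hq, ← hr, Real.exp_nat_mul]
  have hC : (((i + (N - d)).choose n : ℕ) : ℝ) ≤ Real.exp (n + t * d - n * Real.log (1 - Real.exp t)) := by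
    rw [e1, ← le_div_iff₀ (Real.exp_pos _), one_div, ← Real.exp_neg] at hc
    refine hc.trans (Real.exp_le_exp.2 ?_)
    -- Rounding up costs nothing: the exponent contains `i - 1`, which stays below `n / (-t)`.
    have : ((i : ℝ) - 1) * (-t) ≤ n := by
      rw [← le_div_iff₀ ht']; linarith
    linarith
  have hI : (n : ℝ) ^ n * Real.exp (-(n * Real.log (-t))) ≤ (i : ℝ) ^ n := by
    calc (n : ℝ) ^ n * Real.exp (-(n * Real.log (-t))) = ((n : ℝ) / (-t)) ^ n := by
          rw [Real.exp_neg, Real.exp_nat_mul, Real.exp_log ht', div_pow, div_eq_mul_inv]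
      _ ≤ _ := by gcongr
  calc ((n ! : ℕ) : ℝ) * (((i + (N - d)).choose n : ℕ) : ℝ)
      ≤ (Real.exp (n * ε) * ((n : ℝ) ^ n * Real.exp (-n))) *
        Real.exp (n + t * d - n * Real.log (1 - Real.exp t)) := by gcongr
    _ = Real.exp (n * ε) * Real.exp (t * d - n * L t) *
        ((n : ℝ) ^ n * Real.exp (-(n * Real.log (-t)))) := by
      have : Real.exp (-n) * Real.exp (n + t * d - n * Real.log (1 - Real.exp t)) =
          Real.exp (t * d - n * L t) * Real.exp (-(n * Real.log (-t))) := by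
        rw [← Real.exp_add, ← Real.exp_add, L_of_neg ht]
        ring_nf
      linear_combination (Real.exp (n * ε) * (n : ℝ) ^ n) * this
    _ ≤ _ := by gcongr

theorem eventually_weight_le (t : ℝ) {ε : ℝ} (hε : 0 < ε) :
    ∀ᶠ n : ℕ in atTop, ∀ d < n,
      weight (scale t n) n d ≤ Real.exp (n * ε) * Real.exp (t * d - n * L t) := by
  rcases lt_trichotomy t 0 with ht | rfl | ht
  · exact eventually_weight_le_of_neg ht hε
  · filter_upwards [eventually_prod_one_add_bounds 1 hε] with n hn d hd
    rw [L_zero, scale_zero]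
    simpa [weight] using (hn _ fun k hk => abs_sub_div_sq_le hd hk).2
  · have hlarge : ∀ᶠ n : ℕ in atTop, t / (ε / 2) ≤ n :=
      tendsto_natCast_atTop_atTop.eventually_ge_atTop _
    filter_upwards [eventually_weight_le_of_neg (neg_lt_zero.2 ht) (half_pos hε), hlarge]
      with n hn hn2 d hd
    rw [weight_scale_of_pos ht hd]
    refine (hn _ (by omega)).trans ?_
    rw [← Real.exp_add, ← Real.exp_add]
    apply Real.exp_le_exp.2
    have : ((n - 1 - d : ℕ) : ℝ) = n - 1 - d := by
      rw [Nat.sub_sub, Nat.cast_sub (by omega)]; push_cast; ring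
    rw [this, L_eq_add_L_neg t]
    rw [div_le_iff₀ (half_pos hε)] at hn2
    linarith

/-! ### Lower bound for the weights. -/

/-- The exponential growth rate of the weight of scale `a n` at `x n`. -/
noncomputable def weightRate (a x : ℝ) : ℝ := logPrim (a - x + 1) - logPrim (a - x) - Real.log a

theorem eventually_le_weight_of_neg {t x : ℝ} (ht : t < 0) (hx : x < (-t)⁻¹) {ε : ℝ} (hε : 0 < ε) :
    ∃ δ > 0, ∀ᶠ n : ℕ in atTop, ∀ d < n, |(d : ℝ) / n - x| < δ →
      Real.exp (n * (weightRate (-t)⁻¹ x - ε)) ≤ weight (scale t n) n d := by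
  have ht' : 0 < -t := by linarith
  obtain ⟨a, ha⟩ : ∃ a, a = (-t)⁻¹ := ⟨_, rfl⟩
  have ha0 : 0 < a := ha ▸ inv_pos.2 ht'
  rw [← ha] at hx ⊢
  have hcont : ContinuousAt (fun p : ℝ × ℝ => logPrim (p.1 + 1) - logPrim p.1 - Real.log p.2)
      (a - x, a) := by
    refine ContinuousAt.sub (Continuous.continuousAt ?_) (continuousAt_snd.log ha0.ne')
    exact (continuous_logPrim.comp (by fun_prop)).sub (continuous_logPrim.comp continuous_fst)
  have hev := hcont.eventually_const_lt (show weightRate a x - ε < _ from sub_lt_self _ hε)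
  obtain ⟨η, hη, hball⟩ := Metric.eventually_nhds_iff.1 hev
  have hinv : ∀ᶠ n : ℕ in atTop, 1 / (n : ℝ) < min (η / 2) ((a - x) / 2) :=
    (tendsto_const_div_atTop_nhds_zero_nat 1).eventually_lt_const
      (lt_min (by linarith) (by linarith))
  -- One half absorbs the deviation of `d/n` from `x`, the other the `1/n` rounding errors. The
  -- bound by `η` serves continuity, the bound by `a - x` keeps `v` nonnegative.
  refine ⟨min (η / 2) ((a - x) / 2), lt_min (by linarith) (by linarith), ?_⟩
  filter_upwards [hinv, eventually_ge_atTop 1] with n hn hn1 d hd hdx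
  have hn0 : (0 : ℝ) < n := by exact_mod_cast hn1
  rw [lt_min_iff] at hn hdx
  have h0 := scale_ne_zero t hn1
  rw [weight_eq h0]
  rw [scale_of_neg ht] at h0 ⊢
  have hle := Nat.le_ceil ((n : ℝ) / (-t))
  have hlt := Nat.ceil_lt_add_one (a := (n : ℝ) / (-t)) (by positivity)
  rw [show (n : ℝ) / (-t) = n * a by rw [ha, div_eq_mul_inv]] at h0 hle hlt ⊢
  generalize (⌈(n : ℝ) * a⌉₊ : ℝ) = i at *
  obtain ⟨b, hb⟩ : ∃ b, b = i / n := ⟨_, rfl⟩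
  have hi : i = n * b := by rw [hb]; field_simp
  have hb1 : a ≤ b := by rw [hb, le_div_iff₀ hn0]; linarith
  have hb2 : b < a + 1 / n := by rw [hb, div_lt_iff₀ hn0, add_mul]; field_simp; linarith
  obtain ⟨v, hv⟩ : ∃ v, v = b - d / n - 1 / n := ⟨_, rfl⟩
  have hnv : i - d = n * v + 1 := by rw [hv, hi]; field_simp; ring
  obtain ⟨hdx1, hdx1'⟩ := abs_lt.1 hdx.1
  obtain ⟨hdx2, hdx2'⟩ := abs_lt.1 hdx.2
  have hv0 : 0 ≤ v := by linarith [hn.2]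
  have hH := @hball (v, b) (by
    rw [Prod.dist_eq, max_lt_iff, Real.dist_eq, Real.dist_eq, abs_lt, abs_lt]
    refine ⟨⟨?_, ?_⟩, ?_, ?_⟩ <;> dsimp only <;> linarith [hn.1])
  have hbpos : 0 < b := ha0.trans_le hb1
  rw [le_div_iff₀ (by rw [hi]; positivity), hnv]
  refine le_trans ?_ (exp_logPrim_le_rising n (by positivity))
  have hpow : i ^ n = Real.exp (n * (Real.log n + Real.log b)) := by
    rw [← Real.log_mul hn0.ne' hbpos.ne', Real.exp_nat_mul, Real.exp_log (by positivity), hi]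
  rw [hpow, ← Real.exp_add]
  apply Real.exp_le_exp.2
  rw [show (n : ℝ) * v + n = n * (v + 1) by ring, logPrim_mul hn0 hv0, logPrim_mul hn0 (by linarith)]
  have := mul_lt_mul_of_pos_left hH hn0
  dsimp only at this
  nlinarith

/-- At `x = L' t` the growth rate meets the line `x t - L t` of the upper bound: with `a = (-t)⁻¹`,
both `a - x` and `a - x + 1` have explicit logarithms in `exp t`. -/
theorem weightRate_of_hasDerivAt {t x : ℝ} (ht : t < 0) (h : HasDerivAt L x t) :
    x < (-t)⁻¹ ∧ weightRate (-t)⁻¹ x = x * t - L t := by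
  have hz1 : Real.exp t < 1 := by simpa using ht
  have hz0 := Real.exp_pos t
  have hq : 0 < 1 - Real.exp t := by linarith
  have hx : x = Real.exp t / (Real.exp t - 1) - 1 / t := h.unique (hasDerivAt_L_of_ne ht.ne)
  have hy : (-t)⁻¹ - x = Real.exp t / (1 - Real.exp t) := by
    rw [hx, ← neg_sub 1 (Real.exp t), div_neg, inv_neg]; ring
  have hy1 : (-t)⁻¹ - x + 1 = 1 / (1 - Real.exp t) := by
    rw [hy]; field_simp; ring
  refine ⟨?_, ?_⟩
  · have : 0 < Real.exp t / (1 - Real.exp t) := by positivity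
    linarith
  · have hlog : Real.log ((-t)⁻¹ - x) = t - Real.log (1 - Real.exp t) := by
      rw [hy, Real.log_div hz0.ne' hq.ne', Real.log_exp]
    have hlog1 : Real.log ((-t)⁻¹ - x + 1) = -Real.log (1 - Real.exp t) := by
      rw [hy1, one_div, Real.log_inv]
    unfold weightRate logPrim
    rw [hlog, hlog1, Real.log_inv, L_of_neg ht]
    have hinv : (-t)⁻¹ * t = -1 := by rw [inv_neg, neg_mul, inv_mul_cancel₀ ht.ne]
    linear_combination (-1 : ℝ) * hinv

/-- The bound blows up as `a → 0`, that is `t → -∞`, matching the infinite rate at the endpoint `0`,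
where no `t` solves `L' t = 0`. -/
theorem weightRate_zero {a : ℝ} (ha : 0 < a) : -Real.log a - 1 ≤ weightRate a 0 := by
  have h1 : Real.log a ≤ Real.log (a + 1) := Real.log_le_log ha (by linarith)
  have h2 : 0 ≤ Real.log (a + 1) := Real.log_nonneg (by linarith)
  unfold weightRate logPrim
  rw [sub_zero]
  nlinarith

/-- The reflection `d ↦ n - 1 - d` sends `d/n` to `1 - d/n - 1/n`; halving `δ` absorbs the extra
`1/n`. -/
theorem exists_reflect {x t δ : ℝ} (ht : 0 < t) (hδ : 0 < δ) {f : ℕ → ℝ}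
    (h : ∀ᶠ n : ℕ in atTop, ∀ d < n, |(d : ℝ) / n - (1 - x)| < δ →
      f n ≤ weight (scale (-t) n) n d) :
    ∀ᶠ n : ℕ in atTop, ∀ d < n, |(d : ℝ) / n - x| < δ / 2 →
      f n ≤ weight (scale t n) n d := by
  have hinv : ∀ᶠ n : ℕ in atTop, 1 / (n : ℝ) < δ / 2 :=
    (tendsto_const_div_atTop_nhds_zero_nat 1).eventually_lt_const (by linarith)
  filter_upwards [h, hinv, eventually_ge_atTop 1] with n hn hn2 hn1 d hd hdx
  have hn0 : (0 : ℝ) < n := by exact_mod_cast hn1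
  rw [weight_scale_of_pos ht hd]
  refine hn _ (by omega) ?_
  have : ((n - 1 - d : ℕ) : ℝ) = n - 1 - d := by
    rw [Nat.sub_sub, Nat.cast_sub (by omega)]; push_cast; ring
  have hpos : 0 < 1 / (n : ℝ) := by positivity
  rw [this, show ((n : ℝ) - 1 - d) / n - (1 - x) = -(1 / n) - (d / n - x) by field_simp; ring]
  obtain ⟨h1, h2⟩ := abs_lt.1 hdx
  rw [abs_lt]
  constructor <;> linarith

theorem hasDerivAt_L_neg {x t : ℝ} (h : HasDerivAt L x t) : HasDerivAt L (1 - x) (-t) := by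
  have h1 : HasDerivAt (fun s => s + L (-s)) (1 + x * (-1)) (-t) := by
    refine (hasDerivAt_id (-t)).add ?_
    have h' : HasDerivAt L x (-(-t)) := by rwa [neg_neg]
    exact h'.comp (-t) (hasDerivAt_neg (-t))
  have h2 := h1.congr_of_eventuallyEq (Eventually.of_forall L_eq_add_L_neg)
  rwa [mul_neg_one, ← sub_eq_add_neg] at h2

theorem eventually_le_weight_of_hasDerivAt {t x : ℝ} (h : HasDerivAt L x t) {ε : ℝ} (hε : 0 < ε) :
    ∃ δ > 0, ∀ᶠ n : ℕ in atTop, ∀ d < n, |(d : ℝ) / n - x| < δ →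
      Real.exp (n * (x * t - L t - ε)) ≤ weight (scale t n) n d := by
  have key : ∀ t x : ℝ, t < 0 → HasDerivAt L x t →
      ∃ δ > 0, ∀ᶠ n : ℕ in atTop, ∀ d < n, |(d : ℝ) / n - x| < δ →
      Real.exp (n * (x * t - L t - ε)) ≤ weight (scale t n) n d := fun t x ht h => by
    obtain ⟨h1, h2⟩ := weightRate_of_hasDerivAt ht h
    rw [← h2]
    exact eventually_le_weight_of_neg ht h1 hε
  rcases lt_trichotomy t 0 with ht | rfl | ht
  · exact key t x ht h
  · refine ⟨1, one_pos, ?_⟩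
    filter_upwards [eventually_prod_one_add_bounds 1 hε] with n hn d hd _
    rw [L_zero, scale_zero]
    simpa [weight] using (hn _ fun k hk => abs_sub_div_sq_le hd hk).1
  · obtain ⟨δ, hδ, hn⟩ := key (-t) (1 - x) (neg_lt_zero.2 ht) (hasDerivAt_L_neg h)
    refine ⟨δ / 2, half_pos hδ, exists_reflect ht hδ ?_⟩
    rw [L_eq_add_L_neg t]
    convert hn using 7
    ring

theorem eventually_le_weight_zero (α : ℝ) : ∃ t < 0, ∃ δ > 0, ∀ᶠ n : ℕ in atTop, ∀ d < n,
    |(d : ℝ) / n - 0| < δ → Real.exp (n * α) ≤ weight (scale t n) n d := by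
  have ha := Real.exp_pos (α + 2)
  -- This `t` makes the growth rate at `0` at least `α + 1`; the spare unit pays for `ε = 1` below.
  refine ⟨-Real.exp (α + 2), neg_lt_zero.2 ha, ?_⟩
  obtain ⟨δ, hδ, hn⟩ := eventually_le_weight_of_neg (x := 0) (neg_lt_zero.2 ha)
    (by rw [neg_neg]; positivity) one_pos
  refine ⟨δ, hδ, ?_⟩
  filter_upwards [hn] with n hn d hd hdx
  refine le_trans (Real.exp_le_exp.2 ?_) (hn d hd hdx)
  gcongr
  have := weightRate_zero (inv_pos.2 ha)
  rw [Real.log_inv, Real.log_exp] at this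
  rw [neg_neg]
  linarith

/-- Near every point of `[0, 1]` some weight grows almost as fast as the rate function allows. -/
theorem exists_weight_ge {x α : ℝ} (hx : x ∈ Set.Icc (0 : ℝ) 1) (hα : (α : EReal) < rate x) :
    ∃ t, ∃ δ > 0, ∀ᶠ n : ℕ in atTop, ∀ d < n, |(d : ℝ) / n - x| < δ →
      Real.exp (n * α) ≤ weight (scale t n) n d := by
  rcases hx.1.eq_or_lt with rfl | hx0
  · obtain ⟨t, _, h⟩ := eventually_le_weight_zero α
    exact ⟨t, h⟩
  rcases hx.2.eq_or_lt with rfl | hx1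
  · obtain ⟨t, ht, δ, hδ, h⟩ := eventually_le_weight_zero α
    refine ⟨-t, δ / 2, half_pos hδ, exists_reflect (neg_pos.2 ht) hδ ?_⟩
    simpa only [sub_self, neg_neg] using h
  obtain ⟨t, ht, hr⟩ := exists_hasDerivAt_L ⟨hx0, hx1⟩
  rw [hr, EReal.coe_lt_coe_iff] at hα
  obtain ⟨δ, hδ, h⟩ := eventually_le_weight_of_hasDerivAt ht (sub_pos.2 hα)
  refine ⟨t, δ, hδ, ?_⟩
  simpa only [sub_sub_cancel] using h

/-! ### Means over the symmetric group and the tilt. -/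

theorem descents_lt {n : ℕ} (hn : 1 ≤ n) (σ : Equiv.Perm (Fin n)) : descents σ < n := by
  obtain ⟨N, rfl⟩ : ∃ N, n = N + 1 := ⟨n - 1, by omega⟩
  exact Nat.lt_succ_of_le (descents_le σ)

/-- The mean over the symmetric group. -/
noncomputable def permMean {n : ℕ} (f : Equiv.Perm (Fin n) → ℝ) : ℝ := (∑ σ, f σ) / (n ! : ℕ)

theorem permMean_mono {n : ℕ} {f g : Equiv.Perm (Fin n) → ℝ} (h : ∀ σ, f σ ≤ g σ) :
    permMean f ≤ permMean g :=
  div_le_div_of_nonneg_right (Finset.sum_le_sum fun σ _ => h σ) (by positivity)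

theorem permMean_add {n : ℕ} (f g : Equiv.Perm (Fin n) → ℝ) :
    permMean (fun σ => f σ + g σ) = permMean f + permMean g := by
  unfold permMean
  rw [Finset.sum_add_distrib, add_div]

theorem permMean_mul_const {n : ℕ} (f : Equiv.Perm (Fin n) → ℝ) (c : ℝ) :
    permMean (fun σ => f σ * c) = permMean f * c := by
  unfold permMean
  rw [← Finset.sum_mul, div_mul_eq_mul_div]

/-- The normalized pair of the numbers of descents of a permutation and of its inverse. -/
noncomputable def descentPoint {n : ℕ} (σ : Equiv.Perm (Fin n)) : ℝ × ℝ :=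
  ((descents σ : ℝ) / n, (descents σ⁻¹ : ℝ) / n)

theorem descentPoint_mem {n : ℕ} (hn : 1 ≤ n) (σ : Equiv.Perm (Fin n)) :
    descentPoint σ ∈ Set.Icc (0 : ℝ) 1 ×ˢ Set.Icc (0 : ℝ) 1 := by
  have hn0 : (0 : ℝ) < n := by exact_mod_cast hn
  have h1 : (descents σ : ℝ) ≤ n := by exact_mod_cast (descents_lt hn σ).le
  have h2 : (descents σ⁻¹ : ℝ) ≤ n := by exact_mod_cast (descents_lt hn σ⁻¹).le
  exact ⟨⟨by dsimp [descentPoint]; positivity, (div_le_one hn0).2 h1⟩,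
    ⟨by dsimp [descentPoint]; positivity, (div_le_one hn0).2 h2⟩⟩

/-- The mean of `f` over the permutations whose normalized pair lies in `S`. -/
noncomputable def meanOn (n : ℕ) (S : Set (ℝ × ℝ)) (f : Equiv.Perm (Fin n) → ℝ) : ℝ :=
  permMean fun σ => S.indicator (fun _ => f σ) (descentPoint σ)

theorem meanOn_univ {n : ℕ} (f : Equiv.Perm (Fin n) → ℝ) : meanOn n Set.univ f = permMean f := by
  simp [meanOn]

theorem meanOn_le_meanOn {n : ℕ} {S T : Set (ℝ × ℝ)} {f g : Equiv.Perm (Fin n) → ℝ}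
    (hS : ∀ σ : Equiv.Perm (Fin n), descentPoint σ ∈ S → descentPoint σ ∈ T)
    (hfg : ∀ σ, descentPoint σ ∈ S → f σ ≤ g σ) (hg : ∀ σ, 0 ≤ g σ) :
    meanOn n S f ≤ meanOn n T g := by
  refine permMean_mono fun σ => ?_
  by_cases h : descentPoint σ ∈ S
  · rw [Set.indicator_of_mem h, Set.indicator_of_mem (hS σ h)]
    exact hfg σ h
  · rw [Set.indicator_of_notMem h]
    exact Set.indicator_nonneg (fun _ _ => hg σ) _

theorem meanOn_union_le {n : ℕ} (S T : Set (ℝ × ℝ)) {f : Equiv.Perm (Fin n) → ℝ}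
    (hf : ∀ σ, 0 ≤ f σ) : meanOn n (S ∪ T) f ≤ meanOn n S f + meanOn n T f := by
  unfold meanOn
  rw [← permMean_add]
  refine permMean_mono fun σ => ?_
  have hS : 0 ≤ S.indicator (fun _ => f σ) (descentPoint σ) :=
    Set.indicator_nonneg (fun _ _ => hf σ) _
  have hT : 0 ≤ T.indicator (fun _ => f σ) (descentPoint σ) :=
    Set.indicator_nonneg (fun _ _ => hf σ) _
  by_cases h : descentPoint σ ∈ S ∪ T
  · rw [Set.indicator_of_mem h]
    rcases h with h | h
    · rw [Set.indicator_of_mem h]; linarith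
    · rw [Set.indicator_of_mem h]; linarith
  · rw [Set.indicator_of_notMem h]
    linarith

theorem meanOn_le_mul {n : ℕ} {S : Set (ℝ × ℝ)} {f : Equiv.Perm (Fin n) → ℝ} {c : ℝ}
    (hf : ∀ σ, descentPoint σ ∈ S → f σ ≤ c) :
    meanOn n S f ≤ meanOn n S (fun _ => 1) * c := by
  unfold meanOn
  rw [← permMean_mul_const]
  refine permMean_mono fun σ => ?_
  by_cases h : descentPoint σ ∈ S
  · simpa [Set.indicator_of_mem h] using hf σ h
  · simp [Set.indicator_of_notMem h]

/-- The density by which the uniform distribution on the symmetric group is tilted. -/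
noncomputable def tilt (t s : ℝ) {n : ℕ} (σ : Equiv.Perm (Fin n)) : ℝ :=
  weight (scale t n) n (descents σ) * weight (scale s n) n (descents σ⁻¹)

theorem tilt_nonneg (t s : ℝ) {n : ℕ} (σ : Equiv.Perm (Fin n)) : 0 ≤ tilt t s σ := by
  rcases Nat.eq_zero_or_pos n with rfl | hn
  · simp [tilt, weight]
  · exact mul_nonneg (weight_scale_nonneg t (descents_lt hn σ))
      (weight_scale_nonneg s (descents_lt hn σ⁻¹))

theorem exists_real_add_split {a b : EReal} {α : ℝ} (h : (α : EReal) < a + b) :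
    ∃ α₁ α₂ : ℝ, (α₁ : EReal) < a ∧ (α₂ : EReal) < b ∧ α < α₁ + α₂ := by
  by_contra! hcon
  refine h.not_ge (EReal.add_le_of_forall_lt fun a' ha b' hb => ?_)
  induction a' with
  | bot => simp
  | top => simp at ha
  | coe a' =>
    induction b' with
    | bot => simp
    | top => simp at hb
    | coe b' => exact_mod_cast hcon a' b' ha hb

/-! ### The large deviation upper bound. -/

/-- Markov's inequality for the tilt: it exceeds `exp (n (α₁ + α₂))` near `z`, while its mean is
subexponential. -/
theorem exists_nhds_meanOn_le {z : ℝ × ℝ} (hz : z ∈ Set.Icc (0 : ℝ) 1 ×ˢ Set.Icc (0 : ℝ) 1)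
    {α : ℝ} (hα : (α : EReal) < jointRate z) :
    ∃ U ∈ 𝓝 z, ∀ᶠ n : ℕ in atTop, meanOn n U (fun _ => 1) ≤ Real.exp (-(n * α)) := by
  obtain ⟨α₁, α₂, h1, h2, h12⟩ := exists_real_add_split hα
  obtain ⟨t, δ₁, hδ₁, ht⟩ := exists_weight_ge hz.1 h1
  obtain ⟨s, δ₂, hδ₂, hs⟩ := exists_weight_ge hz.2 h2
  refine ⟨Metric.ball z.1 δ₁ ×ˢ Metric.ball z.2 δ₂,
    prod_mem_nhds (Metric.ball_mem_nhds _ hδ₁) (Metric.ball_mem_nhds _ hδ₂), ?_⟩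
  filter_upwards [ht, hs, eventually_mean_weight_bounds t s (sub_pos.2 h12),
    eventually_ge_atTop 1] with n ht hs hm hn
  have key : meanOn n (Metric.ball z.1 δ₁ ×ˢ Metric.ball z.2 δ₂) (fun _ => 1) ≤
      meanOn n Set.univ fun σ => tilt t s σ * Real.exp (-(n * (α₁ + α₂))) := by
    refine meanOn_le_meanOn (fun _ _ => trivial) (fun σ hσ => ?_)
      (fun σ => mul_nonneg (tilt_nonneg t s σ) (Real.exp_pos _).le)
    have ha := ht _ (descents_lt hn σ) (by simpa [Real.dist_eq, descentPoint] using hσ.1)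
    have hb := hs _ (descents_lt hn σ⁻¹) (by simpa [Real.dist_eq, descentPoint] using hσ.2)
    have hab : Real.exp (n * α₁) * Real.exp (n * α₂) ≤ tilt t s σ :=
      mul_le_mul ha hb (Real.exp_pos _).le ((Real.exp_pos _).le.trans ha)
    calc (1 : ℝ) = Real.exp (n * α₁) * Real.exp (n * α₂) * Real.exp (-(n * (α₁ + α₂))) := by
          rw [← Real.exp_add, ← Real.exp_add, ← Real.exp_zero]; ring_nf
      _ ≤ _ := by gcongr
  rw [meanOn_univ, permMean_mul_const] at key
  refine key.trans ?_
  calc _ ≤ Real.exp (n * (α₁ + α₂ - α)) * Real.exp (-(n * (α₁ + α₂))) := by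
        gcongr; exact hm.2
    _ = _ := by rw [← Real.exp_add]; ring_nf

theorem eventually_meanOn_le {S : Set (ℝ × ℝ)} {α : ℝ}
    (hα : ∀ z ∈ closure S, (α : EReal) < jointRate z) :
    ∃ C : ℝ, ∀ᶠ n : ℕ in atTop, meanOn n S (fun _ => 1) ≤ C * Real.exp (-(n * α)) := by
  have hK : IsCompact (closure S ∩ (Set.Icc (0 : ℝ) 1 ×ˢ Set.Icc (0 : ℝ) 1)) :=
    (isCompact_Icc.prod isCompact_Icc).inter_left isClosed_closure
  -- Finite covers merely add the constants; all descent points lie in the unit square, so this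
  -- compact part of the closure suffices.
  obtain ⟨C, hC⟩ := hK.induction_on
    (p := fun T => ∃ C : ℝ, ∀ᶠ n : ℕ in atTop,
      meanOn n T (fun _ => 1) ≤ C * Real.exp (-(n * α)))
    ⟨0, Eventually.of_forall fun n => by simp [meanOn, permMean]⟩
    (fun T T' hTT' ⟨C, hC⟩ => ⟨C, hC.mono fun n hn => le_trans
      (meanOn_le_meanOn (fun σ h => hTT' h) (fun _ _ => le_rfl) (fun _ => zero_le_one)) hn⟩)
    (fun T T' ⟨C, hC⟩ ⟨C', hC'⟩ => ⟨C + C', by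
      filter_upwards [hC, hC'] with n h h'
      rw [add_mul]
      exact (meanOn_union_le T T' fun _ => zero_le_one).trans (add_le_add h h')⟩)
    (fun z hz => by
      obtain ⟨U, hU, h⟩ := exists_nhds_meanOn_le hz.2 (hα z hz.1)
      exact ⟨U, mem_nhdsWithin_of_mem_nhds hU, 1, by simpa using h⟩)
  refine ⟨C, ?_⟩
  filter_upwards [hC, eventually_ge_atTop 1] with n h hn
  exact h.trans' (meanOn_le_meanOn (fun σ hσ => ⟨subset_closure hσ, descentPoint_mem hn σ⟩)
    (fun _ _ => le_rfl) (fun _ => zero_le_one))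

theorem eventually_meanOn_le_exp {S : Set (ℝ × ℝ)} {α : ℝ}
    (hα : (α : EReal) < ⨅ z ∈ closure S, jointRate z) :
    ∀ᶠ n : ℕ in atTop, meanOn n S (fun _ => 1) ≤ Real.exp (-(n * α)) := by
  obtain ⟨α', h1, h2⟩ := EReal.lt_iff_exists_real_btwn.1 hα
  rw [EReal.coe_lt_coe_iff] at h1
  obtain ⟨C, hC⟩ := eventually_meanOn_le fun z hz => h2.trans_le (iInf₂_le z hz)
  filter_upwards [hC, eventually_mul_le_exp |C| (sub_pos.2 h1), eventually_ge_atTop 1]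
    with n hC hn hn1
  have h1n : (1 : ℝ) ≤ (n : ℝ) ^ 2 := by exact_mod_cast Nat.one_le_pow _ _ hn1
  calc _ ≤ C * Real.exp (-(n * α')) := hC
    _ ≤ Real.exp (n * (α' - α)) * Real.exp (-(n * α')) := by
        gcongr
        exact (le_abs_self C).trans ((le_mul_of_one_le_right (abs_nonneg C) h1n).trans hn)
    _ = _ := by rw [← Real.exp_add]; ring_nf

/-! ### The large deviation lower bound. -/

theorem eventually_tilt_le (t s : ℝ) {ε : ℝ} (hε : 0 < ε) :
    ∀ᶠ n : ℕ in atTop, ∀ σ : Equiv.Perm (Fin n), tilt t s σ ≤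
      Real.exp (n * (t * (descentPoint σ).1 + s * (descentPoint σ).2 - L t - L s + ε)) := by
  filter_upwards [eventually_weight_le t (half_pos hε), eventually_weight_le s (half_pos hε),
    eventually_ge_atTop 1] with n ht hs hn σ
  have hn0 : (n : ℝ) ≠ 0 := by positivity
  have ha := ht _ (descents_lt hn σ)
  have hb := hs _ (descents_lt hn σ⁻¹)
  refine (mul_le_mul ha hb (weight_scale_nonneg s (descents_lt hn σ⁻¹)) (by positivity)).trans_eq ?_
  rw [← Real.exp_add, ← Real.exp_add, ← Real.exp_add]
  congr 1
  simp only [descentPoint]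
  field_simp
  ring

theorem lt_jointRate_of_ne {z z' : ℝ × ℝ} {t s : ℝ} (ht : HasDerivAt L z.1 t)
    (hs : HasDerivAt L z.2 s) (hne : z' ≠ z) :
    ((t * z'.1 + s * z'.2 - L t - L s : ℝ) : EReal) < jointRate z' := by
  have e : ((t * z'.1 + s * z'.2 - L t - L s : ℝ) : EReal) =
      ((z'.1 * t - L t : ℝ) : EReal) + ((z'.2 * s - L s : ℝ) : EReal) := by
    rw [← EReal.coe_add]; congr 1; ring
  rw [e]
  by_cases h1 : z'.1 = z.1
  · have h2 : z'.2 ≠ z.2 := fun h2 => hne (Prod.ext h1 h2)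
    exact (EReal.add_lt_add_left_coe (lt_rate_of_ne hs h2) _).trans_le
      (add_le_add (le_rate _ _) le_rfl)
  · exact (EReal.add_lt_add_right_coe (lt_rate_of_ne ht h1) _).trans_le
      (add_le_add le_rfl (le_rate _ _))

/-- Outside a neighbourhood of the point selected by the tilt, the tilted mass is exponentially
small. -/
theorem eventually_meanOn_tilt_le {z : ℝ × ℝ} {t s : ℝ} (ht : HasDerivAt L z.1 t)
    (hs : HasDerivAt L z.2 s) {V : Set (ℝ × ℝ)} (hV : IsOpen V) (hz : z ∈ V) :
    ∃ η > 0, ∃ C : ℝ, ∀ᶠ n : ℕ in atTop,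
      meanOn n Vᶜ (tilt t s) ≤ C * Real.exp (-(n * η)) := by
  have hK : IsCompact (Vᶜ ∩ (Set.Icc (0 : ℝ) 1 ×ˢ Set.Icc (0 : ℝ) 1)) :=
    (isCompact_Icc.prod isCompact_Icc).inter_left hV.isClosed_compl
  obtain ⟨η, hη, C, hC⟩ := hK.induction_on
    (p := fun T => ∃ η > 0, ∃ C : ℝ, ∀ᶠ n : ℕ in atTop,
      meanOn n T (tilt t s) ≤ C * Real.exp (-(n * η)))
    ⟨1, one_pos, 0, Eventually.of_forall fun n => by simp [meanOn, permMean]⟩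
    (fun T T' hTT' ⟨η, hη, C, hC⟩ => ⟨η, hη, C, hC.mono fun n hn => le_trans
      (meanOn_le_meanOn (fun σ h => hTT' h) (fun _ _ => le_rfl) (tilt_nonneg t s)) hn⟩)
    (fun T T' ⟨η, hη, C, hC⟩ ⟨η', hη', C', hC'⟩ => ⟨min η η', lt_min hη hη', |C| + |C'|, by
      filter_upwards [hC, hC'] with n h h'
      rw [add_mul]
      refine (meanOn_union_le T T' (tilt_nonneg t s)).trans (add_le_add (h.trans ?_) (h'.trans ?_))
      · gcongr
        · exact le_abs_self C
        · exact min_le_left _ _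
      · gcongr
        · exact le_abs_self C'
        · exact min_le_right _ _⟩)
    (fun z' hz' => by
      have hne : z' ≠ z := fun h => hz'.1 (h ▸ hz)
      obtain ⟨α, hqα, hα⟩ := EReal.lt_iff_exists_real_btwn.1 (lt_jointRate_of_ne ht hs hne)
      rw [EReal.coe_lt_coe_iff] at hqα
      -- The gap is split in three: one `η` for the variation of the linear form, one for the error
      -- in the tilt, and one as the surviving decay rate.
      obtain ⟨η, hη⟩ : ∃ η, η = (α - (t * z'.1 + s * z'.2 - L t - L s)) / 3 := ⟨_, rfl⟩
      have hη0 : 0 < η := by linarith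
      obtain ⟨U, hU, h⟩ := exists_nhds_meanOn_le hz'.2 hα
      have hO : IsOpen {w : ℝ × ℝ | t * w.1 + s * w.2 < t * z'.1 + s * z'.2 + η} :=
        isOpen_lt (by fun_prop) (by fun_prop)
      refine ⟨U ∩ {w : ℝ × ℝ | t * w.1 + s * w.2 < t * z'.1 + s * z'.2 + η},
        mem_nhdsWithin_of_mem_nhds (inter_mem hU (hO.mem_nhds (by simpa using hη0))),
        η, hη0, 1, ?_⟩
      filter_upwards [h, eventually_tilt_le t s hη0] with n hn htilt
      refine (meanOn_le_mul (c := Real.exp (n * (α - η))) fun σ hσ => (htilt σ).trans ?_).trans ?_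
      · apply Real.exp_le_exp.2
        have := hσ.2
        simp only [Set.mem_ofPred_eq] at this
        gcongr
        linarith
      · calc _ ≤ Real.exp (-(n * α)) * Real.exp (n * (α - η)) := by
              gcongr
              exact le_trans (meanOn_le_meanOn (fun σ h => h.1) (fun _ _ => le_rfl)
                (fun _ => zero_le_one)) hn
          _ = _ := by rw [← Real.exp_add, one_mul]; ring_nf)
  refine ⟨η, hη, C, ?_⟩
  filter_upwards [hC, eventually_ge_atTop 1] with n h hn
  exact h.trans' (meanOn_le_meanOn (fun σ hσ => ⟨hσ, descentPoint_mem hn σ⟩)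
    (fun _ _ => le_rfl) (tilt_nonneg t s))

theorem eventually_le_meanOn {G : Set (ℝ × ℝ)} {z : ℝ × ℝ} (hz : z ∈ interior G) {β : ℝ}
    (hβ : jointRate z < β) :
    ∀ᶠ n : ℕ in atTop, Real.exp (-(n * β)) ≤ meanOn n G (fun _ => 1) := by
  obtain ⟨hr1, hr2⟩ := rate_lt_top_of_jointRate_lt_top (hβ.trans (EReal.coe_lt_top β))
  obtain ⟨t, ht, hrt⟩ := exists_hasDerivAt_L (mem_Ioo_of_rate_lt_top hr1)
  obtain ⟨s, hs, hrs⟩ := exists_hasDerivAt_L (mem_Ioo_of_rate_lt_top hr2)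
  rw [jointRate, hrt, hrs, ← EReal.coe_add, EReal.coe_lt_coe_iff] at hβ
  -- On `V` the tilt is at most `exp (n (β - 2 ε))`, two of the four `ε` being spent on the linear
  -- form and the tilt error. The others cover the loss `exp (-(n ε))` in the tilted mass and the
  -- factor `1 / 2`.
  obtain ⟨ε, hε⟩ : ∃ ε, ε = (β - (z.1 * t - L t + (z.2 * s - L s))) / 4 := ⟨_, rfl⟩
  have hε0 : 0 < ε := by linarith
  have hO : IsOpen {w : ℝ × ℝ | t * w.1 + s * w.2 < t * z.1 + s * z.2 + ε} :=
    isOpen_lt (by fun_prop) (by fun_prop)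
  obtain ⟨V, hVdef⟩ : ∃ V, V = interior G ∩
    {w : ℝ × ℝ | t * w.1 + s * w.2 < t * z.1 + s * z.2 + ε} := ⟨_, rfl⟩
  have hV : IsOpen V := hVdef ▸ isOpen_interior.inter hO
  have hzV : z ∈ V := by
    rw [hVdef]
    exact ⟨hz, by simpa using hε0⟩
  obtain ⟨η, hη, C, hC⟩ := eventually_meanOn_tilt_le ht hs hV hzV
  -- With `η / 2` the total tilted mass eventually exceeds twice the mass outside `V`, which decays
  -- at rate `η`.
  have hθ : 0 < min ε (η / 2) := lt_min hε0 (half_pos hη)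
  filter_upwards [hC, eventually_mean_weight_bounds t s hθ, eventually_tilt_le t s hε0,
    eventually_mul_le_exp (2 * |C|) (half_pos hη), eventually_mul_le_exp 2 hε0,
    eventually_ge_atTop 1] with n hC hm htilt hlarge hlarge2 hn
  have hn1 : (1 : ℝ) ≤ (n : ℝ) ^ 2 := by exact_mod_cast Nat.one_le_pow _ _ hn
  have hupper : meanOn n V (tilt t s) ≤ meanOn n G (fun _ => 1) * Real.exp (n * (β - 2 * ε)) := by
    refine (meanOn_le_mul (c := Real.exp (n * (β - 2 * ε))) fun σ hσ =>
      (htilt σ).trans ?_).trans ?_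
    · apply Real.exp_le_exp.2
      have := (hVdef ▸ hσ :).2
      simp only [Set.mem_ofPred_eq] at this
      gcongr
      linarith
    · gcongr
      exact meanOn_le_meanOn (fun σ h => interior_subset (hVdef ▸ h :).1) (fun _ _ => le_rfl)
        (fun _ => zero_le_one)
  have hsplit := meanOn_union_le (n := n) V Vᶜ (tilt_nonneg t s)
  rw [Set.union_compl_self, meanOn_univ] at hsplit
  have htot : Real.exp (-(n * min ε (η / 2))) ≤ permMean (tilt t s : Equiv.Perm (Fin n) → ℝ) := hm.1
  have hsmall : C * Real.exp (-(n * η)) ≤ 1 / 2 * Real.exp (-(n * min ε (η / 2))) := by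
    have h1 : 2 * |C| ≤ Real.exp (n * (η / 2)) := by
      refine le_trans ?_ hlarge
      exact le_mul_of_one_le_right (by positivity) hn1
    calc C * Real.exp (-(n * η)) ≤ (1 / 2 * Real.exp (n * (η / 2))) * Real.exp (-(n * η)) := by
          gcongr
          linarith [le_abs_self C]
      _ = 1 / 2 * Real.exp (-(n * (η / 2))) := by rw [mul_assoc, ← Real.exp_add]; ring_nf
      _ ≤ _ := by
          gcongr
          exact min_le_right _ _
  have hhalf : 1 / 2 * Real.exp (-(n * ε)) ≤ meanOn n V (tilt t s) := by
    have : Real.exp (-(n * ε)) ≤ Real.exp (-(n * min ε (η / 2))) := by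
      gcongr
      exact min_le_left _ _
    linarith
  have h2 : 2 ≤ Real.exp (n * ε) := le_trans (by linarith) hlarge2
  have hfin : Real.exp (-(n * β)) * Real.exp (n * (β - 2 * ε)) ≤
      meanOn n G (fun _ => 1) * Real.exp (n * (β - 2 * ε)) := by
    refine le_trans ?_ (hhalf.trans hupper)
    calc Real.exp (-(n * β)) * Real.exp (n * (β - 2 * ε))
        = Real.exp (-(n * ε)) * Real.exp (-(n * ε)) := by
          rw [← Real.exp_add, ← Real.exp_add]; ring_nf
      _ ≤ 1 / 2 * Real.exp (-(n * ε)) := by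
          gcongr
          rw [Real.exp_neg, one_div]
          exact inv_anti₀ two_pos h2
  exact le_of_mul_le_mul_right hfin (Real.exp_pos _)

/-! ### From counting to measures. -/

theorem measurable_of_fiber {n : ℕ} {Ω : Type*} [MeasurableSpace Ω] {P : Measure Ω}
    {π : Ω → Equiv.Perm (Fin n)} (h : IsUniformPerm P π) {X : Type*} [MeasurableSpace X]
    (f : Equiv.Perm (Fin n) → X) : Measurable fun ω => f (π ω) := by
  intro S _
  have : (fun ω => f (π ω)) ⁻¹' S = ⋃ σ ∈ f ⁻¹' S, π ⁻¹' {σ} := by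
    ext ω; simp
  rw [this]
  exact MeasurableSet.biUnion (Set.to_countable _) fun σ _ => h.measurableSet_fiber σ

theorem map_descentPoint_apply {n : ℕ} {Ω : Type*} [MeasurableSpace Ω] {P : Measure Ω}
    {π : Ω → Equiv.Perm (Fin n)} (h : IsUniformPerm P π) {S : Set (ℝ × ℝ)} (hS : MeasurableSet S) :
    P.map (fun ω => descentPoint (π ω)) S = ENNReal.ofReal (meanOn n S fun _ => 1) := by
  classical
  rw [Measure.map_apply (measurable_of_fiber h descentPoint) hS]
  have : (fun ω => descentPoint (π ω)) ⁻¹' S =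
      ⋃ σ ∈ Finset.univ.filter (fun σ : Equiv.Perm (Fin n) => descentPoint σ ∈ S), π ⁻¹' {σ} := by
    ext ω; simp
  rw [this, measure_biUnion_finset]
  · simp only [h.measure_fiber, Finset.sum_const, nsmul_eq_mul, meanOn, permMean]
    have e : (∑ σ : Equiv.Perm (Fin n), S.indicator (fun _ => (1 : ℝ)) (descentPoint σ)) =
        (Finset.univ.filter fun σ : Equiv.Perm (Fin n) => descentPoint σ ∈ S).card := by
      rw [Finset.card_filter]
      push_cast
      refine Finset.sum_congr rfl fun σ _ => ?_
      simp [Set.indicator_apply]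
    rw [e, ENNReal.ofReal_div_of_pos (by positivity), ENNReal.ofReal_natCast,
      ENNReal.ofReal_natCast, div_eq_mul_inv]
  · intro σ _ τ _ hne
    exact Disjoint.preimage π (by simpa using hne)
  · exact fun σ _ => h.measurableSet_fiber σ

theorem log_ofReal_exp_div {n : ℕ} (hn : 1 ≤ n) (β : ℝ) :
    ENNReal.log (ENNReal.ofReal (Real.exp (-(n * β)))) / (n : EReal) = ((-β : ℝ) : EReal) := by
  have hn0 : (n : ℝ) ≠ 0 := by positivity
  rw [ENNReal.log_ofReal_of_pos (Real.exp_pos _), Real.log_exp, ← EReal.coe_natCast,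
    ← EReal.coe_div]
  congr 1
  field_simp

/-- Extended reals are determined by the real numbers above or below them, so bounds with real
exponents suffice, also when an infimum is infinite. -/
theorem satisfiesLDP_of_exponential_bounds {X : Type*} [TopologicalSpace X] [MeasurableSpace X]
    [BorelSpace X] {μ : ℕ → Measure X} {I : X → EReal} (hI : IsGoodRateFunction I)
    (hlow : ∀ Γ, MeasurableSet Γ → ∀ z ∈ interior Γ, ∀ β : ℝ, I z < β →
      ∀ᶠ n : ℕ in atTop, ENNReal.ofReal (Real.exp (-(n * β))) ≤ μ n Γ)
    (hup : ∀ Γ, MeasurableSet Γ → ∀ α : ℝ, (α : EReal) < ⨅ z ∈ closure Γ, I z →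
      ∀ᶠ n : ℕ in atTop, μ n Γ ≤ ENNReal.ofReal (Real.exp (-(n * α)))) :
    SatisfiesLDP μ I where
  isGoodRateFunction := hI
  lower_bound Γ hΓ := by
    rw [EReal.neg_le]
    refine le_iInf₂ fun z hz => EReal.le_of_forall_lt_iff_le.1 fun β hβ => ?_
    rw [EReal.neg_le, ← EReal.coe_neg]
    refine le_liminf_of_le ?_ ?_
    · isBoundedDefault
    · filter_upwards [hlow Γ hΓ z hz β hβ, eventually_ge_atTop 1] with n hn hn1
      rw [← log_ofReal_exp_div hn1]
      exact EReal.div_le_div_right_of_nonneg (by positivity) (ENNReal.log_le_log hn)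
  upper_bound Γ hΓ := by
    rw [EReal.le_neg]
    refine EReal.ge_of_forall_gt_iff_ge.1 fun α hα => ?_
    rw [EReal.le_neg, ← EReal.coe_neg]
    refine limsup_le_of_le ?_ ?_
    · isBoundedDefault
    · filter_upwards [hup Γ hΓ α hα, eventually_ge_atTop 1]
        with n hn hn1
      rw [← log_ofReal_exp_div hn1]
      exact EReal.div_le_div_right_of_nonneg (by positivity) (ENNReal.log_le_log hn)

end DescentLDP

theorem theorem4p1 {Ω : ℕ → Type*} [∀ n, MeasurableSpace (Ω n)]
    (P : ∀ n, Measure (Ω n)) [∀ n, IsProbabilityMeasure (P n)]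
    (π : ∀ n, Ω n → Equiv.Perm (Fin n))
    (hπ : ∀ n, 1 ≤ n → DescentLDP.IsUniformPerm (P n) (π n)) :
    DescentLDP.SatisfiesLDP
      (fun n => (P n).map fun ω =>
        (((DescentLDP.descents (π n ω) : ℝ) / (n : ℝ),
          (DescentLDP.descents (π n ω)⁻¹ : ℝ) / (n : ℝ)) : ℝ × ℝ))
      DescentLDP.jointRate := by
  refine DescentLDP.satisfiesLDP_of_exponential_bounds
    DescentLDP.isGoodRateFunction_jointRate (fun Γ hΓ z hz β hβ => ?_) (fun Γ hΓ α hα => ?_)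
  · filter_upwards [DescentLDP.eventually_le_meanOn hz hβ, eventually_ge_atTop 1] with n hn hn1
    exact (ENNReal.ofReal_le_ofReal hn).trans_eq
      (DescentLDP.map_descentPoint_apply (hπ n hn1) hΓ).symm
  · filter_upwards [DescentLDP.eventually_meanOn_le_exp hα, eventually_ge_atTop 1] with n hn hn1
    exact (DescentLDP.map_descentPoint_apply (hπ n hn1) hΓ).trans_le (ENNReal.ofReal_le_ofReal hn)
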